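/- Let $\rho>0$, $a_0>0$, and for real $\varepsilon$ put $a_\varepsilon^2=a_0^2-\varepsilon$ and $V_\varepsilon(x)=-a_\varepsilon^2$ for $|x|\le\rho$, $V_\varepsilon(x)=0$ for $|x|>\rho$, $x\in\mathbb R^2$. Let $J_\ell$ and $H^{(1)}_\ell$ be the Bessel and Hankel functions of the first kind, with the branch of $H^{(1)}_\ell(z)$ that is continuous on $-\pi/2\le\arg z<3\pi/2$, and let $\gamma$ be Euler's constant. A resonant state of $-\Delta+V_\varepsilon$ at $\lambda\in\mathbb C$ is a function $u\in L^2_{\mathrm{loc}}(\mathbb R^2)$, $u\not\equiv0$, with $(-\Delta+V_\varepsilon-\lambda^2)u=0$ in the sense of distributions which is outgoing, that is, for large $r$ it has an expansion $u(r,\theta)=\sum_{\ell\in\mathbb Z}c_\ell H^{(1)}_\ell(\lambda r)e^{i\ell\theta}$ if $\lambda\ne0$, and $u(r,\theta)=\sum_{\ell\in\mathbb Z}c_\ell r^{-|\ell|}e^{i\ell\theta}$ if $\lambda=0$. We say that $\lambda$ is a resonance in the $\ell=0$ mode if there is a radial resonant state at $\lambda$. Suppose that for some $\varepsilon_1>0$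 and every $\varepsilon\in(-\varepsilon_1,0)$ there is a nontrivial radial function $\psi_\varepsilon\in L^2(\mathbb R^2)$ with $(-\Delta+V_\varepsilon-E_\varepsilon)\psi_\varepsilon=0$, where $E_\varepsilon\in\mathbb R$ and $E_\varepsilon\uparrow0$ (that is, $E_\varepsilon\to 0$ through negative values) as $\varepsilon\uparrow0$. Then: 1. $J_1(\rho a_0)=0$. 2. There are $\delta_0,\varepsilon_0>0$ such that for $0<\varepsilon<\varepsilon_0$ the operator $-\Delta+V_\varepsilon$ has no resonance in the $\ell=0$ mode in $\{\lambda\in\mathbb C: 0\le|\lambda|<\delta_0,\ |\arg\lambda|\le\pi/2\}$ (the point $\lambda=0$ is included). 3. As $\varepsilon\uparrow0$, $$E_\varepsilon=-\frac{4}{\rho^2}\,e^{4/(\rho^2\varepsilon)-2\gamma}\,(1+O(\varepsilon)).$$ -/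

import Mathlib

open scoped ContDiff

noncomputable section

namespace CircularWell

open MeasureTheory

/-! ### Bessel and Hankel functions on the plane cut along the negative imaginary axis -/

/-- The logarithm of `z ≠ 0` with imaginary part in `[-π/2, 3π/2)`. -/
def cutLog (z : ℂ) : ℂ :=
  starRingEnd ℂ (Complex.log (starRingEnd ℂ (-Complex.I * z))) + Complex.I * (Real.pi / 2)

/-- The Bessel function of the first kind
`J_ν(z) = (z/2)^ν ∑_k (-z²/4)^k / (k! Γ(ν+k+1))`, for `z ≠ 0`, with `-π/2 ≤ arg z < 3π/2`.
(Mathlib sets `Γ = 0` at the poles of `Γ`, so that `(Γ s)⁻¹` is the entire function `1/Γ`.) -/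
def besselJ (ν z : ℂ) : ℂ :=
  Complex.exp (ν * cutLog (z / 2)) *
    ∑' k : ℕ, (-z ^ 2 / 4) ^ k * ((k.factorial : ℂ) * Complex.Gamma (ν + k + 1))⁻¹

/-- The Bessel function of the second kind of integer order,
`Y_ℓ(z) = π⁻¹ ∂_ν J_ν(z)|_{ν=ℓ} + (-1)^ℓ π⁻¹ ∂_ν J_ν(z)|_{ν=-ℓ}`. -/
def besselY (l : ℤ) (z : ℂ) : ℂ :=
  (1 / Real.pi) * deriv (fun ν : ℂ => besselJ ν z) (l : ℂ) +
    ((-1) ^ l / Real.pi) * deriv (fun ν : ℂ => besselJ ν z) (-(l : ℂ))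

/-- The Hankel function of the first kind `H_ℓ^{(1)} = J_ℓ + i Y_ℓ` of integer order. -/
def hankel1 (l : ℤ) (z : ℂ) : ℂ :=
  besselJ l z + Complex.I * besselY l z

/-! ### Schrödinger operators on the plane

The plane `ℝ²` is `ℂ` with its real inner product and Lebesgue measure; thus `r = ‖x‖` and
`e^{iℓθ} = (x / ‖x‖)^ℓ`. -/

/-- `u ∈ L²_loc(ℝ²)` and `(-Δ + V - z) u = 0` in the sense of distributions. -/
def IsSolution (V : ℂ → ℝ) (z : ℂ) (u : ℂ → ℂ) : Prop :=
  (∀ K : Set ℂ, IsCompact K → MemLp u 2 (volume.restrict K)) ∧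
  ∀ φ : ℂ → ℂ, ContDiff ℝ ∞ φ → HasCompactSupport φ →
    ∫ x : ℂ, u x * (-((Laplacian.laplacian φ : ℂ → ℂ) x) + ((V x : ℂ) - z) * φ x) = 0

/-- `u` is not the zero element of `L²_loc`. -/
def IsNontrivial (u : ℂ → ℂ) : Prop :=
  ¬ (∀ᵐ x : ℂ, u x = 0)

/-- `u` is (almost everywhere) a function of `r = ‖x‖` only. -/
def IsRadial (u : ℂ → ℂ) : Prop :=
  ∃ f : ℝ → ℂ, ∀ᵐ x : ℂ, u x = f ‖x‖

/-- `ψ` is an `L²` eigenfunction of `-Δ + V` with eigenvalue `E`. -/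
def IsEigenfunction (V : ℂ → ℝ) (E : ℝ) (ψ : ℂ → ℂ) : Prop :=
  MemLp ψ 2 volume ∧ IsNontrivial ψ ∧ IsSolution V (E : ℂ) ψ

/-- The outgoing condition: for large `r`,
`u = ∑_ℓ c_ℓ H_ℓ^{(1)}(λ r) e^{iℓθ}` if `λ ≠ 0`, and `u = ∑_ℓ c_ℓ r^{-|ℓ|} e^{iℓθ}` if `λ = 0`. -/
def IsOutgoing (lam : ℂ) (u : ℂ → ℂ) : Prop :=
  ∃ (c : ℤ → ℂ) (R : ℝ), ∀ᵐ x : ℂ, R < ‖x‖ →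
    HasSum (fun l : ℤ => c l *
        (if lam = 0 then (‖x‖ : ℂ) ^ (-|l|) else hankel1 l (lam * ‖x‖)) * (x / ‖x‖) ^ l)
      (u x)

/-- `u` is a resonant state of `-Δ + V` at `λ`, so that `λ` is a resonance. -/
def IsResonantState (V : ℂ → ℝ) (lam : ℂ) (u : ℂ → ℂ) : Prop :=
  IsNontrivial u ∧ IsSolution V (lam ^ 2) u ∧ IsOutgoing lam u

open Classical in
/-- The circular well `-a² 𝟙_{r ≤ ρ}`, as a function of `ρ` and of `a²`. -/
def circularWell (ρ asq : ℝ) (x : ℂ) : ℝ :=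
  if ‖x‖ ≤ ρ then -asq else 0

end CircularWell

end

/-! A radial solution is, in the variable `s = r²`, a multiple of `J₀(√(c s))` inside the well, and
it must continue outside as the decaying or outgoing solution, so that a Wronskian at the edge
vanishes: the logarithmic derivatives agree there. As `E ↑ 0` the logarithmic derivative of the
decaying solution `K₀` tends to `0` like `1 / log (-E)`, so the limiting interior argument `ρ a₀`
must be a zero of `J₀' = -J₁`. By the Riccati equation the interior logarithmic derivative is
linear at such a zero up to a cubic error, and matching it with the expansion of `K₀` at the origin
gives the asymptotics of `E`. For `ε > 0` a resonance at `λ` close to `0` would force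
`(ε ρ² / 4) L → 1 / 2`, where the coefficient `L` of the outgoing solution has real part
`log |λ| + O(1) → -∞`; since `ε > 0` this is impossible. -/

noncomputable section

namespace CircularWell

open Asymptotics Filter MeasureTheory Set Topology

local notation "γ" => Real.eulerMascheroniConstant

/-! ### Entire power series -/

/-- `a` is the coefficient sequence of a power series that converges absolutely on the whole plane;
see `entireSum` for its sum. -/
def IsEntireCoeff (a : ℕ → ℂ) : Prop :=
  ∀ R : ℝ, 0 < R → Summable fun k => ‖a k‖ * R ^ k

/-- The sum of the power series with coefficients `a`, an entire function when `IsEntireCoeff a`. -/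
def entireSum (a : ℕ → ℂ) (w : ℂ) : ℂ := ∑' k : ℕ, a k * w ^ k

/-- The coefficients of the derivative of the power series with coefficients `a`. -/
def derivCoeff (a : ℕ → ℂ) (k : ℕ) : ℂ := (k + 1) * a (k + 1)

lemma isEntireCoeff_of_norm_le_inv_factorial {a : ℕ → ℂ}
    (ha : ∀ k, ‖a k‖ ≤ (k.factorial : ℝ)⁻¹) : IsEntireCoeff a := fun R hR =>
  .of_nonneg_of_le (fun k => by positivity)
    (fun k => by rw [div_eq_inv_mul]; gcongr; exact ha k) (Real.summable_pow_div_factorial R)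

lemma entireSum_zero (a : ℕ → ℂ) : entireSum a 0 = a 0 := by
  rw [entireSum, tsum_eq_single 0 fun k hk => by simp [hk]]
  simp

namespace IsEntireCoeff

variable {a : ℕ → ℂ}

lemma derivCoeff (ha : IsEntireCoeff a) : IsEntireCoeff (derivCoeff a) := fun R hR => by
  have succ_le_two_pow (k : ℕ) : ‖(k + 1 : ℂ)‖ ≤ 2 ^ (k + 1) := by
    rw [← Nat.cast_succ, Complex.norm_natCast]
    exact_mod_cast Nat.lt_two_pow_self.le
  refine .of_nonneg_of_le (fun k => by positivity) (fun k => ?_)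
    (((summable_nat_add_iff 1).2 (ha (2 * R) (by positivity))).mul_left (1 / R))
  calc ‖CircularWell.derivCoeff a k‖ * R ^ k = ‖(k + 1 : ℂ)‖ * (‖a (k + 1)‖ * R ^ k) := by
        rw [CircularWell.derivCoeff, norm_mul, mul_assoc]
    _ ≤ 2 ^ (k + 1) * (‖a (k + 1)‖ * R ^ k) := by gcongr; exact succ_le_two_pow k
    _ = 1 / R * (‖a (k + 1)‖ * (2 * R) ^ (k + 1)) := by
        rw [mul_pow, pow_succ R]; field_simp

lemma hasSum (ha : IsEntireCoeff a) (w : ℂ) :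
    HasSum (fun k => a k * w ^ k) (entireSum a w) := by
  refine (Summable.of_norm_bounded (ha (‖w‖ + 1) (by positivity)) fun k => ?_).hasSum
  rw [norm_mul, norm_pow]
  gcongr
  linarith

lemma hasDerivAt (ha : IsEntireCoeff a) (w : ℂ) :
    HasDerivAt (entireSum a) (entireSum (CircularWell.derivCoeff a) w) w := by
  have hw : w ∈ Metric.ball (0 : ℂ) (‖w‖ + 1) := by simp
  have diff (k : ℕ) : DifferentiableOn ℂ (fun v : ℂ => a k * v ^ k)
      (Metric.ball (0 : ℂ) (‖w‖ + 1)) := by fun_prop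
  have norm_le (k : ℕ) (v : ℂ) (hv : v ∈ Metric.ball (0 : ℂ) (‖w‖ + 1)) :
      ‖a k * v ^ k‖ ≤ ‖a k‖ * (‖w‖ + 1) ^ k := by
    rw [norm_mul, norm_pow]
    gcongr
    exact (mem_ball_zero_iff.1 hv).le
  have hsum := ha (‖w‖ + 1) (by positivity)
  have termwise : HasSum (fun k => CircularWell.derivCoeff a k * w ^ k)
      (deriv (entireSum a) w) := by
    convert! (hasSum_nat_add_iff' 1).2
      (Complex.hasSum_deriv_of_summable_norm hsum diff Metric.isOpen_ball norm_le hw) using 1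
    · ext k
      simp only [deriv_const_mul_field', deriv_pow_field, Nat.add_sub_cancel,
        CircularWell.derivCoeff]
      push_cast
      ring
    · simp only [Finset.range_one, Finset.sum_singleton, pow_zero, mul_one, deriv_const, sub_zero]
      rfl
  rw [(ha.derivCoeff.hasSum w).unique termwise]
  exact ((Complex.differentiableOn_tsum_of_summable_norm hsum diff Metric.isOpen_ball
    norm_le).differentiableAt (Metric.isOpen_ball.mem_nhds hw)).hasDerivAt

lemma deriv_entireSum (ha : IsEntireCoeff a) :
    deriv (entireSum a) = entireSum (CircularWell.derivCoeff a) :=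
  funext fun w => (ha.hasDerivAt w).deriv

lemma differentiable (ha : IsEntireCoeff a) : Differentiable ℂ (entireSum a) :=
  fun w => (ha.hasDerivAt w).differentiableAt

lemma mul_deriv_deriv_add (ha : IsEntireCoeff a) (w : ℂ) :
    w * deriv (deriv (entireSum a)) w + deriv (entireSum a) w + entireSum a w =
      entireSum (fun k => (k + 1) ^ 2 * a (k + 1) + a k) w := by
  have second : HasSum (fun k : ℕ => (k : ℂ) * CircularWell.derivCoeff a k * w ^ k)
      (w * entireSum (CircularWell.derivCoeff (CircularWell.derivCoeff a)) w) := by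
    rw [← hasSum_nat_add_iff' 1]
    simp only [Finset.range_one, Finset.sum_singleton, Nat.cast_zero, zero_mul, sub_zero]
    convert! (ha.derivCoeff.derivCoeff.hasSum w).mul_left w using 1
    ext k
    simp only [CircularWell.derivCoeff]; push_cast; ring
  have total := (second.add (ha.derivCoeff.hasSum w)).add (ha.hasSum w)
  rw [ha.deriv_entireSum, ha.derivCoeff.deriv_entireSum, ← total.tsum_eq, entireSum]
  refine tsum_congr fun k => ?_
  rw [CircularWell.derivCoeff]; ring

end IsEntireCoeff

/-! ### Bessel–Clifford functions -/

/-- The coefficients of `cliffordJ`. -/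
def jCoeff (k : ℕ) : ℂ := (-1) ^ k / (k.factorial : ℂ) ^ 2

/-- The coefficients of `cliffordN`. -/
def nCoeff (k : ℕ) : ℂ := (harmonic k : ℂ) * jCoeff k

/-- The Bessel–Clifford function `w ↦ J₀(2√w)`, as an entire function of `w`. -/
def cliffordJ : ℂ → ℂ := entireSum jCoeff

/-- The entire part of the Bessel function of the second kind of order zero:
`(π / 2) Y₀(2√w) = (log w / 2 + γ) J₀(2√w) - cliffordN w`. -/
def cliffordN : ℂ → ℂ := entireSum nCoeff

lemma norm_jCoeff (k : ℕ) : ‖jCoeff k‖ = ((k.factorial : ℝ) ^ 2)⁻¹ := by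
  simp [jCoeff]

lemma norm_harmonic_le_factorial (k : ℕ) : ‖(harmonic k : ℂ)‖ ≤ k.factorial := by
  have harmonic_le : harmonic k ≤ k := by
    refine (Finset.sum_le_card_nsmul _ _ 1 fun i _ => ?_).trans (by simp)
    exact inv_le_one_of_one_le₀ (by exact_mod_cast i.succ_pos)
  have harmonic_nonneg : 0 ≤ harmonic k := Finset.sum_nonneg fun _ _ => by positivity
  rw [← Complex.ofReal_ratCast, Complex.norm_real,
    Real.norm_of_nonneg (by exact_mod_cast harmonic_nonneg)]
  exact_mod_cast harmonic_le.trans (by exact_mod_cast k.self_le_factorial)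

lemma isEntireCoeff_jCoeff : IsEntireCoeff jCoeff :=
  isEntireCoeff_of_norm_le_inv_factorial fun k => by
    rw [norm_jCoeff]
    exact inv_anti₀ (by positivity)
      (le_self_pow₀ (by exact_mod_cast k.factorial_pos) two_ne_zero)

lemma isEntireCoeff_nCoeff : IsEntireCoeff nCoeff :=
  isEntireCoeff_of_norm_le_inv_factorial fun k => by
    calc ‖nCoeff k‖ ≤ k.factorial * ((k.factorial : ℝ) ^ 2)⁻¹ := by
          rw [nCoeff, norm_mul, norm_jCoeff]
          gcongr
          exact norm_harmonic_le_factorial k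
      _ = (k.factorial : ℝ)⁻¹ := by field_simp

lemma succ_sq_mul_jCoeff_succ (k : ℕ) : (k + 1 : ℂ) ^ 2 * jCoeff (k + 1) = -jCoeff k := by
  have succ_ne_zero : (k + 1 : ℂ) ≠ 0 := by exact_mod_cast k.succ_ne_zero
  have factorial_ne_zero : (k.factorial : ℂ) ≠ 0 := by exact_mod_cast k.factorial_ne_zero
  rw [jCoeff, jCoeff, Nat.factorial_succ]
  push_cast
  field_simp
  ring

lemma differentiable_cliffordJ : Differentiable ℂ cliffordJ := isEntireCoeff_jCoeff.differentiable

lemma differentiable_cliffordN : Differentiable ℂ cliffordN := isEntireCoeff_nCoeff.differentiable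

lemma hasDerivAt_cliffordJ (w : ℂ) : HasDerivAt cliffordJ (deriv cliffordJ w) w :=
  (differentiable_cliffordJ w).hasDerivAt

lemma hasDerivAt_cliffordN (w : ℂ) : HasDerivAt cliffordN (deriv cliffordN w) w :=
  (differentiable_cliffordN w).hasDerivAt

lemma hasDerivAt_deriv_cliffordJ (w : ℂ) :
    HasDerivAt (deriv cliffordJ) (deriv (deriv cliffordJ) w) w :=
  (differentiable_cliffordJ.deriv w).hasDerivAt

lemma hasDerivAt_deriv_cliffordN (w : ℂ) :
    HasDerivAt (deriv cliffordN) (deriv (deriv cliffordN) w) w :=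
  (differentiable_cliffordN.deriv w).hasDerivAt

@[fun_prop]
lemma continuous_cliffordJ : Continuous cliffordJ := differentiable_cliffordJ.continuous

@[fun_prop]
lemma continuous_cliffordN : Continuous cliffordN := differentiable_cliffordN.continuous

@[fun_prop]
lemma continuous_deriv_cliffordJ : Continuous (deriv cliffordJ) :=
  differentiable_cliffordJ.deriv.continuous

@[fun_prop]
lemma continuous_deriv_cliffordN : Continuous (deriv cliffordN) :=
  differentiable_cliffordN.deriv.continuous

lemma cliffordJ_zero : cliffordJ 0 = 1 := by simp [cliffordJ, entireSum_zero, jCoeff]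

lemma cliffordN_zero : cliffordN 0 = 0 := by simp [cliffordN, entireSum_zero, nCoeff]

lemma cliffordJ_ode (w : ℂ) :
    w * deriv (deriv cliffordJ) w + deriv cliffordJ w + cliffordJ w = 0 := by
  rw [cliffordJ, isEntireCoeff_jCoeff.mul_deriv_deriv_add]
  simp [succ_sq_mul_jCoeff_succ, entireSum]

/-- The source term comes from the factor `½ log w` of the logarithmic solution
`(½ log w) cliffordJ w - cliffordN w` of the homogeneous equation. -/
lemma cliffordN_ode (w : ℂ) :
    w * deriv (deriv cliffordN) w + deriv cliffordN w + cliffordN w = deriv cliffordJ w := by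
  rw [cliffordN, isEntireCoeff_nCoeff.mul_deriv_deriv_add, cliffordJ,
    isEntireCoeff_jCoeff.deriv_entireSum]
  refine tsum_congr fun k => ?_
  have succ_ne_zero : (k + 1 : ℂ) ≠ 0 := by exact_mod_cast k.succ_ne_zero
  have jCoeff_eq : jCoeff k = -((k + 1 : ℂ) ^ 2 * jCoeff (k + 1)) := by
    rw [succ_sq_mul_jCoeff_succ, neg_neg]
  simp only [nCoeff, derivCoeff, harmonic_succ, jCoeff_eq]
  push_cast
  field_simp
  ring

lemma one_le_norm_cliffordJ_neg {y : ℝ} (hy : 0 ≤ y) : 1 ≤ ‖cliffordJ (-(y : ℂ))‖ := by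
  have series : HasSum (fun k : ℕ => ((y ^ k / (k.factorial : ℝ) ^ 2 : ℝ) : ℂ))
      (cliffordJ (-(y : ℂ))) := by
    convert! isEntireCoeff_jCoeff.hasSum (-(y : ℂ)) using 2 with k
    rw [jCoeff, neg_pow (y : ℂ), div_mul_eq_mul_div, ← mul_assoc, ← mul_pow]
    norm_num
  have re_series := Complex.hasSum_re series
  calc 1 = y ^ 0 / (Nat.factorial 0 : ℝ) ^ 2 := by simp
    _ ≤ (cliffordJ (-(y : ℂ))).re := le_hasSum re_series 0 fun k _ => by
        rw [Complex.ofReal_re]; positivity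
    _ ≤ ‖cliffordJ (-(y : ℂ))‖ := Complex.re_le_norm _

/-! ### Bessel and Hankel functions of small order -/

lemma conj_neg_I_mul_ne_zero {z : ℂ} (hz : z ≠ 0) : starRingEnd ℂ (-Complex.I * z) ≠ 0 := by
  simpa using hz

lemma exp_cutLog {z : ℂ} (hz : z ≠ 0) : Complex.exp (cutLog z) = z := by
  rw [cutLog, Complex.exp_add, Complex.exp_conj, Complex.exp_log (conj_neg_I_mul_ne_zero hz),
    Complex.conj_conj, mul_comm Complex.I (_ / 2), Complex.exp_pi_div_two_mul_I]
  linear_combination (-z) * Complex.I_mul_I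

lemma cutLog_ofReal_mul {r : ℝ} (hr : 0 < r) {z : ℂ} (hz : z ≠ 0) :
    cutLog (r * z) = Real.log r + cutLog z := by
  rw [cutLog, cutLog, mul_left_comm, map_mul, Complex.conj_ofReal,
    Complex.log_ofReal_mul hr (conj_neg_I_mul_ne_zero hz), map_add, Complex.conj_ofReal, add_assoc]

lemma besselJ_zero (z : ℂ) : besselJ 0 z = cliffordJ (z ^ 2 / 4) := by
  rw [besselJ, zero_mul, Complex.exp_zero, one_mul]
  refine tsum_congr fun k => ?_
  rw [zero_add, Complex.Gamma_nat_eq_factorial, jCoeff, neg_div, neg_pow]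
  field_simp

lemma besselJ_one {z : ℂ} (hz : z ≠ 0) :
    besselJ 1 z = -(z / 2) * deriv cliffordJ (z ^ 2 / 4) := by
  rw [besselJ, one_mul, exp_cutLog (div_ne_zero hz two_ne_zero), neg_mul, ← mul_neg, cliffordJ,
    isEntireCoeff_jCoeff.deriv_entireSum, entireSum, ← tsum_neg]
  congr 1
  refine tsum_congr fun k => ?_
  have succ_ne_zero : (k + 1 : ℂ) ≠ 0 := by exact_mod_cast k.succ_ne_zero
  have factorial_ne_zero : (k.factorial : ℂ) ≠ 0 := by exact_mod_cast k.factorial_ne_zero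
  rw [add_comm (1 : ℂ), ← Nat.cast_succ, Complex.Gamma_nat_eq_factorial, derivCoeff, jCoeff,
    Nat.factorial_succ, neg_div, neg_pow (z ^ 2 / 4)]
  push_cast
  field_simp
  ring

lemma differentiable_inv_Gamma_add (s : ℂ) :
    Differentiable ℂ fun ν : ℂ => (Complex.Gamma (ν + s))⁻¹ :=
  Complex.differentiable_one_div_Gamma.comp (differentiable_id.add_const s)

lemma hasDerivAt_inv_Gamma_add_succ (k : ℕ) :
    HasDerivAt (fun ν : ℂ => (Complex.Gamma (ν + (k + 1)))⁻¹)
      ((γ - harmonic k) / k.factorial) 0 := by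
  have factorial_ne_zero : (k.factorial : ℂ) ≠ 0 := by exact_mod_cast k.factorial_ne_zero
  have deriv_Gamma : HasDerivAt (fun ν : ℂ => Complex.Gamma (ν + (k + 1)))
      (k.factorial * (-γ + harmonic k)) 0 :=
    HasDerivAt.comp_add_const (0 : ℂ) (k + 1)
      (by rw [zero_add]; exact Complex.hasDerivAt_Gamma_nat k)
  refine (deriv_Gamma.inv ?_).congr_deriv ?_
  · rwa [zero_add, Complex.Gamma_nat_eq_factorial]
  · rw [zero_add, Complex.Gamma_nat_eq_factorial]
    field_simp
    ring

lemma exists_norm_inv_Gamma_add_succ_le :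
    ∃ C : ℝ, ∀ ν ∈ Metric.ball (0 : ℂ) (1 / 2), ∀ k : ℕ,
      ‖(Complex.Gamma (ν + (k + 1)))⁻¹‖ ≤ C * 2 ^ k := by
  obtain ⟨C, hC⟩ := (isCompact_closedBall (0 : ℂ) (1 / 2)).exists_bound_of_continuousOn
    (differentiable_inv_Gamma_add 1).continuous.continuousOn
  refine ⟨C, fun ν hν k => ?_⟩
  induction k with
  | zero => simpa using hC ν (Metric.ball_subset_closedBall hν)
  | succ k ih =>
    have half_le : 1 / 2 ≤ ‖ν + (k + 1)‖ := by
      have norm_succ : ‖(k + 1 : ℂ)‖ = k + 1 := by exact_mod_cast Complex.norm_natCast (k + 1)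
      have := norm_sub_norm_le (k + 1 : ℂ) (-ν)
      rw [sub_neg_eq_add, norm_neg, norm_succ, add_comm (k + 1 : ℂ)] at this
      linarith [mem_ball_zero_iff.1 hν, (k.cast_nonneg : (0 : ℝ) ≤ k)]
    have ne_zero : ν + (k + 1) ≠ 0 := norm_pos_iff.1 (by linarith)
    calc ‖(Complex.Gamma (ν + ((k + 1 : ℕ) + 1)))⁻¹‖
        = ‖ν + (k + 1)‖⁻¹ * ‖(Complex.Gamma (ν + (k + 1)))⁻¹‖ := by
          rw [Nat.cast_succ, ← add_assoc ν, Complex.Gamma_add_one _ ne_zero, mul_inv, norm_mul,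
            norm_inv]
      _ ≤ 2 * (C * 2 ^ k) := by
          gcongr
          rw [inv_le_comm₀ (by linarith) two_pos]
          linarith
      _ = C * 2 ^ (k + 1) := by ring

/-- The power series factor of `besselJ ν z`, as a function of `x = -z² / 4`. -/
def besselSeries (x ν : ℂ) : ℂ :=
  ∑' k : ℕ, x ^ k * ((k.factorial : ℂ) * Complex.Gamma (ν + k + 1))⁻¹

lemma besselSeries_zero (w : ℂ) : besselSeries (-w) 0 = cliffordJ w := by
  refine tsum_congr fun k => ?_
  rw [zero_add, Complex.Gamma_nat_eq_factorial, jCoeff, neg_pow]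
  field_simp

lemma hasDerivAt_besselSeries (w : ℂ) :
    HasDerivAt (besselSeries (-w)) (γ * cliffordJ w - cliffordN w) 0 := by
  obtain ⟨C, hC⟩ := exists_norm_inv_Gamma_add_succ_le
  set term : ℕ → ℂ → ℂ := fun k ν =>
    (-w) ^ k * (k.factorial : ℂ)⁻¹ * (Complex.Gamma (ν + (k + 1)))⁻¹ with term_def
  have series_eq : besselSeries (-w) = fun ν => ∑' k, term k ν :=
    funext fun ν => tsum_congr fun k => by rw [term_def, mul_inv, ← mul_assoc, add_assoc]
  have diff (k : ℕ) : DifferentiableOn ℂ (term k) (Metric.ball 0 (1 / 2)) :=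
    ((differentiable_inv_Gamma_add _).const_mul _).differentiableOn
  have norm_le (k : ℕ) (ν : ℂ) (hν : ν ∈ Metric.ball (0 : ℂ) (1 / 2)) :
      ‖term k ν‖ ≤ C * ((2 * ‖w‖) ^ k / k.factorial) := by
    calc ‖term k ν‖ ≤ ‖w‖ ^ k * (k.factorial : ℝ)⁻¹ * (C * 2 ^ k) := by
          rw [norm_mul, norm_mul, norm_inv, norm_pow, norm_neg, Complex.norm_natCast]
          gcongr
          exact hC ν hν k
      _ = C * ((2 * ‖w‖) ^ k / k.factorial) := by rw [mul_pow]; ring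
  have summable_bound := (Real.summable_pow_div_factorial (2 * ‖w‖)).mul_left C
  have zero_mem : (0 : ℂ) ∈ Metric.ball (0 : ℂ) (1 / 2) := by simp
  have deriv_term (k : ℕ) : deriv (term k) 0 = γ * (jCoeff k * w ^ k) - nCoeff k * w ^ k := by
    rw [((hasDerivAt_inv_Gamma_add_succ k).const_mul _).deriv, nCoeff, jCoeff, neg_pow]
    field_simp
  have hasSum_deriv : HasSum (fun k => deriv (term k) 0) (γ * cliffordJ w - cliffordN w) := by
    simp only [deriv_term]
    exact ((isEntireCoeff_jCoeff.hasSum w).mul_left _).sub (isEntireCoeff_nCoeff.hasSum w)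
  rw [series_eq, hasSum_deriv.unique (Complex.hasSum_deriv_of_summable_norm summable_bound diff
    Metric.isOpen_ball norm_le zero_mem)]
  exact ((Complex.differentiableOn_tsum_of_summable_norm summable_bound diff Metric.isOpen_ball
    norm_le).differentiableAt (Metric.isOpen_ball.mem_nhds zero_mem)).hasDerivAt

lemma hasDerivAt_besselJ_order (z : ℂ) :
    HasDerivAt (fun ν : ℂ => besselJ ν z)
      ((cutLog (z / 2) + γ) * cliffordJ (z ^ 2 / 4) - cliffordN (z ^ 2 / 4)) 0 := by
  have deriv_power : HasDerivAt (fun ν : ℂ => Complex.exp (ν * cutLog (z / 2)))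
      (cutLog (z / 2)) 0 := by
    simpa using ((hasDerivAt_id (0 : ℂ)).mul_const (cutLog (z / 2))).cexp
  have deriv_series := hasDerivAt_besselSeries (z ^ 2 / 4)
  rw [← neg_div] at deriv_series
  refine (deriv_power.mul deriv_series).congr_deriv ?_
  rw [neg_div, besselSeries_zero, zero_mul, Complex.exp_zero]
  ring

lemma hankel1_zero (z : ℂ) :
    hankel1 0 z = (2 * Complex.I / Real.pi) *
      ((cutLog (z / 2) + γ - Complex.I * (Real.pi / 2)) * cliffordJ (z ^ 2 / 4) -
        cliffordN (z ^ 2 / 4)) := by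
  have pi_ne_zero : (Real.pi : ℂ) ≠ 0 := by exact_mod_cast Real.pi_ne_zero
  rw [hankel1, besselY, Int.cast_zero, neg_zero, (hasDerivAt_besselJ_order z).deriv, besselJ_zero,
    zpow_zero]
  field_simp
  linear_combination (Real.pi * cliffordJ (z ^ 2 / 4)) * Complex.I_sq

/-! ### The solution decaying on the negative axis -/

/-- The integral `∫₀^∞ e^{-t-y/t} t^{s-1} dt`, which is `2 y^{s/2} K_s(2√y)` for the Macdonald
function `K_s`. -/
def macdonald (s y : ℝ) : ℝ := ∫ t in Ioi (0 : ℝ), Real.exp (-t - y / t) * t ^ (s - 1)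

/-- The derivative `∫₀^∞ log t e^{-t-y/t} t^{s-1} dt` of `macdonald s y` with respect to `s`. -/
def macdonaldLog (s y : ℝ) : ℝ :=
  ∫ t in Ioi (0 : ℝ), Real.log t * (Real.exp (-t - y / t) * t ^ (s - 1))

lemma exp_neg_sub_div_mul_rpow_le {y t : ℝ} (hy : 0 < y) (ht : 0 < t) (s : ℝ) (n : ℕ) :
    Real.exp (-t - y / t) * t ^ (s - 1) ≤
      n.factorial / y ^ n * (Real.exp (-t) * t ^ (s + n - 1)) := by
  have pow_le := Real.pow_div_factorial_le_exp (x := y / t) (by positivity) n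
  have exp_le : Real.exp (-(y / t)) ≤ n.factorial / y ^ n * t ^ n := by
    rw [Real.exp_neg, inv_le_comm₀ (Real.exp_pos _) (by positivity)]
    refine le_of_eq_of_le ?_ pow_le
    rw [div_pow]
    field_simp
  calc Real.exp (-t - y / t) * t ^ (s - 1)
      = Real.exp (-t) * t ^ (s - 1) * Real.exp (-(y / t)) := by
        rw [sub_eq_add_neg (-t), Real.exp_add]
        ring
    _ ≤ Real.exp (-t) * t ^ (s - 1) * (n.factorial / y ^ n * t ^ n) := by gcongr
    _ = n.factorial / y ^ n * (Real.exp (-t) * t ^ (s + n - 1)) := by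
        rw [add_sub_right_comm, Real.rpow_add_natCast ht.ne']
        ring

lemma continuousOn_exp_neg_sub_div_mul_rpow (s y : ℝ) :
    ContinuousOn (fun t : ℝ => Real.exp (-t - y / t) * t ^ (s - 1)) (Ioi 0) :=
  (continuousOn_id.neg.sub (continuousOn_const.div continuousOn_id
    fun _ ht => (mem_Ioi.1 ht).ne')).rexp.mul
    (continuousOn_id.rpow_const fun _ ht => Or.inl (mem_Ioi.1 ht).ne')

lemma integrableOn_exp_neg_sub_div_mul_rpow {y : ℝ} (hy : 0 < y) (s : ℝ) :
    IntegrableOn (fun t : ℝ => Real.exp (-t - y / t) * t ^ (s - 1)) (Ioi 0) := by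
  obtain ⟨n, hn⟩ := exists_nat_gt (-s)
  refine Integrable.mono' ((Real.GammaIntegral_convergent (s := s + n) (by linarith)).const_mul
    (n.factorial / y ^ n))
    ((continuousOn_exp_neg_sub_div_mul_rpow s y).aestronglyMeasurable measurableSet_Ioi) ?_
  filter_upwards [ae_restrict_mem measurableSet_Ioi] with t ht
  have t_pos : 0 < t := ht
  rw [Real.norm_of_nonneg (by positivity)]
  exact exp_neg_sub_div_mul_rpow_le hy ht s n

lemma hasDerivAt_macdonald (s : ℝ) {y : ℝ} (hy : 0 < y) :
    HasDerivAt (macdonald s) (-macdonald (s - 1) y) y := by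
  have nhds : Ioi (y / 2) ∈ 𝓝 y := Ioi_mem_nhds (half_lt_self hy)
  have integrable {z : ℝ} (hz : z ∈ Ioi (y / 2)) (s : ℝ) :=
    integrableOn_exp_neg_sub_div_mul_rpow ((half_pos hy).trans hz) s
  rw [macdonald, ← integral_neg]
  refine (hasDerivAt_integral_of_dominated_loc_of_deriv_le
    (μ := volume.restrict (Ioi (0 : ℝ)))
    (F := fun z t => Real.exp (-t - z / t) * t ^ (s - 1))
    (F' := fun z t => -(Real.exp (-t - z / t) * t ^ (s - 1 - 1)))
    (bound := fun t => Real.exp (-t - y / 2 / t) * t ^ (s - 1 - 1)) nhds ?_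
    (integrableOn_exp_neg_sub_div_mul_rpow hy s)
    (integrableOn_exp_neg_sub_div_mul_rpow hy (s - 1)).neg.1 ?_
    (integrableOn_exp_neg_sub_div_mul_rpow (half_pos hy) (s - 1)) ?_).2
  · filter_upwards [nhds] with z hz using (integrable hz s).1
  · filter_upwards [ae_restrict_mem measurableSet_Ioi] with t ht z hz
    have t_pos : 0 < t := ht
    rw [norm_neg, Real.norm_of_nonneg (by positivity)]
    gcongr
    exact (mem_Ioi.1 hz).le
  · filter_upwards [ae_restrict_mem measurableSet_Ioi] with t ht z _
    have t_pos : 0 < t := ht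
    have deriv_exponent : HasDerivAt (fun z : ℝ => -t - z / t) (-(1 / t)) z :=
      ((hasDerivAt_id z).div_const t).const_sub (-t)
    refine (deriv_exponent.exp.mul_const _).congr_deriv ?_
    rw [Real.rpow_sub_one t_pos.ne' (s - 1)]
    ring

lemma macdonald_nonneg (s y : ℝ) : 0 ≤ macdonald s y :=
  setIntegral_nonneg measurableSet_Ioi fun t ht => by
    have t_pos : 0 < t := ht
    positivity

lemma macdonald_le {s y : ℝ} (hy : 0 < y) (n : ℕ) (hs : 0 < s + n) :
    macdonald s y ≤ n.factorial / y ^ n * Real.Gamma (s + n) := by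
  rw [Real.Gamma_eq_integral hs, ← integral_const_mul]
  exact setIntegral_mono_on (integrableOn_exp_neg_sub_div_mul_rpow hy s)
    ((Real.GammaIntegral_convergent hs).const_mul _) measurableSet_Ioi
    fun t ht => exp_neg_sub_div_mul_rpow_le hy ht s n

lemma macdonald_zero_le {y : ℝ} (hy : 0 < y) : macdonald 0 y ≤ 1 / y := by
  simpa using macdonald_le (s := 0) hy 1 (by norm_num)

lemma integral_comp_div_Ioi {y : ℝ} (hy : 0 < y) (g : ℝ → ℝ) :
    ∫ t in Ioi (0 : ℝ), y / t ^ 2 * g (y / t) = ∫ t in Ioi (0 : ℝ), g t := by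
  have scaling := integral_comp_mul_left_Ioi' g 0 hy
  rw [mul_zero, smul_eq_mul, ← integral_const_mul] at scaling
  rw [← scaling, ← integral_comp_rpow_Ioi (fun x => y * g (y * x)) (neg_ne_zero.2 one_ne_zero)]
  refine setIntegral_congr_fun measurableSet_Ioi fun t ht => ?_
  have t_pos : 0 < t := ht
  have rpow_eq : t ^ ((-1 : ℝ) - 1) = (t ^ 2)⁻¹ := by
    rw [Real.rpow_sub_one t_pos.ne', Real.rpow_neg_one]
    field_simp
  rw [rpow_eq, Real.rpow_neg_one, abs_neg, abs_one, one_mul, smul_eq_mul, ← div_eq_mul_inv]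
  ring

lemma exp_mul_rpow_comp_div (s : ℝ) {y t : ℝ} (hy : 0 < y) (ht : 0 < t) :
    y / t ^ 2 * (Real.exp (-(y / t) - y / (y / t)) * (y / t) ^ (s - 1)) =
      y ^ s * (Real.exp (-t - y / t) * t ^ (-s - 1)) := by
  have exponent_eq : -(y / t) - y / (y / t) = -t - y / t := by
    field_simp
    ring
  rw [exponent_eq, Real.rpow_sub_one (div_pos hy ht).ne', Real.rpow_sub_one ht.ne',
    Real.div_rpow hy.le ht.le, Real.rpow_neg ht.le]
  field_simp

lemma rpow_mul_macdonald_neg (s : ℝ) {y : ℝ} (hy : 0 < y) :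
    y ^ s * macdonald (-s) y = macdonald s y := by
  rw [macdonald, macdonald, ← integral_const_mul, ← integral_comp_div_Ioi hy
    (fun t => Real.exp (-t - y / t) * t ^ (s - 1))]
  exact setIntegral_congr_fun measurableSet_Ioi fun t ht => (exp_mul_rpow_comp_div s hy ht).symm

lemma macdonald_neg_one {y : ℝ} (hy : 0 < y) : macdonald (-1) y = macdonald 1 y / y := by
  rw [← rpow_mul_macdonald_neg 1 hy, Real.rpow_one, mul_div_cancel_left₀ _ hy.ne']

lemma abs_log_le_rpow {t : ℝ} (ht : 0 < t) :
    |Real.log t| ≤ 4 * (t ^ (1 / 4 : ℝ) + t ^ (-(1 / 4) : ℝ)) := by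
  have log_le := Real.log_le_rpow_div ht.le (show (0 : ℝ) < 1 / 4 by norm_num)
  have neg_log_le := Real.log_le_rpow_div (inv_pos.2 ht).le (show (0 : ℝ) < 1 / 4 by norm_num)
  rw [Real.log_inv, Real.inv_rpow ht.le, ← Real.rpow_neg ht.le] at neg_log_le
  have rpow_pos : 0 < t ^ (1 / 4 : ℝ) := by positivity
  have rpow_neg_pos : 0 < t ^ (-(1 / 4) : ℝ) := by positivity
  exact abs_le.2 ⟨by linarith, by linarith⟩

lemma abs_log_mul_rpow_le {t : ℝ} (ht : 0 < t) (s : ℝ) :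
    |Real.log t| * t ^ (s - 1) ≤ 4 * (t ^ (s + 1 / 4 - 1) + t ^ (s - 1 / 4 - 1)) :=
  calc |Real.log t| * t ^ (s - 1)
      ≤ 4 * (t ^ (1 / 4 : ℝ) + t ^ (-(1 / 4) : ℝ)) * t ^ (s - 1) := by
        gcongr
        exact abs_log_le_rpow ht
    _ = 4 * (t ^ (s + 1 / 4 - 1) + t ^ (s - 1 / 4 - 1)) := by
        rw [mul_assoc, add_mul, ← Real.rpow_add ht, ← Real.rpow_add ht]
        ring_nf

lemma integrableOn_log_mul_mul_rpow {f : ℝ → ℝ} {s : ℝ}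
    (hadd : IntegrableOn (fun t => f t * t ^ (s + 1 / 4 - 1)) (Ioi 0))
    (hsub : IntegrableOn (fun t => f t * t ^ (s - 1 / 4 - 1)) (Ioi 0))
    (hf : ContinuousOn f (Ioi 0)) :
    IntegrableOn (fun t => Real.log t * (f t * t ^ (s - 1))) (Ioi 0) := by
  refine Integrable.mono' ((hadd.norm.add hsub.norm).const_mul 4)
    (((Real.continuousOn_log.mono fun _ ht => (mem_Ioi.1 ht).ne').mul
      (hf.mul (continuousOn_id.rpow_const fun _ ht => Or.inl (mem_Ioi.1 ht).ne')))
      |>.aestronglyMeasurable measurableSet_Ioi) ?_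
  filter_upwards [ae_restrict_mem measurableSet_Ioi] with t ht
  have t_pos : 0 < t := ht
  have rpow_norm (r : ℝ) : ‖t ^ r‖ = t ^ r := Real.norm_of_nonneg (by positivity)
  simp only [Pi.add_apply, norm_mul, rpow_norm, Real.norm_eq_abs (Real.log t)]
  calc |Real.log t| * (‖f t‖ * t ^ (s - 1)) = ‖f t‖ * (|Real.log t| * t ^ (s - 1)) := by ring
    _ ≤ ‖f t‖ * (4 * (t ^ (s + 1 / 4 - 1) + t ^ (s - 1 / 4 - 1))) :=
        mul_le_mul_of_nonneg_left (abs_log_mul_rpow_le t_pos s) (norm_nonneg _)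
    _ = 4 * (‖f t‖ * t ^ (s + 1 / 4 - 1) + ‖f t‖ * t ^ (s - 1 / 4 - 1)) := by ring

lemma integrableOn_log_mul_exp_neg_sub_div_mul_rpow {y : ℝ} (hy : 0 < y) (s : ℝ) :
    IntegrableOn (fun t : ℝ => Real.log t * (Real.exp (-t - y / t) * t ^ (s - 1))) (Ioi 0) :=
  integrableOn_log_mul_mul_rpow (f := fun t => Real.exp (-t - y / t))
    (integrableOn_exp_neg_sub_div_mul_rpow hy _) (integrableOn_exp_neg_sub_div_mul_rpow hy _)
    (by simpa using continuousOn_exp_neg_sub_div_mul_rpow 1 y)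

lemma rpow_mul_macdonaldLog_neg (s : ℝ) {y : ℝ} (hy : 0 < y) :
    y ^ s * macdonaldLog (-s) y = Real.log y * macdonald s y - macdonaldLog s y := by
  have swap : macdonaldLog s y = ∫ t in Ioi (0 : ℝ), y ^ s *
      (Real.log y * (Real.exp (-t - y / t) * t ^ (-s - 1)) -
        Real.log t * (Real.exp (-t - y / t) * t ^ (-s - 1))) := by
    rw [macdonaldLog, ← integral_comp_div_Ioi hy
      (fun t => Real.log t * (Real.exp (-t - y / t) * t ^ (s - 1)))]
    refine setIntegral_congr_fun measurableSet_Ioi fun t ht => ?_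
    have t_pos : 0 < t := ht
    change y / t ^ 2 * (Real.log (y / t) * _) = _
    rw [mul_left_comm, exp_mul_rpow_comp_div s hy t_pos, Real.log_div hy.ne' t_pos.ne']
    ring
  rw [swap, integral_const_mul, integral_sub
    ((integrableOn_exp_neg_sub_div_mul_rpow hy (-s)).const_mul _)
    (integrableOn_log_mul_exp_neg_sub_div_mul_rpow hy (-s)), integral_const_mul,
    ← rpow_mul_macdonald_neg s hy, macdonaldLog, macdonald]
  ring

lemma tendsto_log_mul_exp_neg_sub_div {y : ℝ} (hy : 0 < y) :
    Tendsto (fun t : ℝ => Real.log t * Real.exp (-t - y / t)) (𝓝[>] 0) (𝓝 0) := by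
  have log_mul_tendsto : Tendsto (fun t : ℝ => 1 / y * ‖t * Real.log t‖) (𝓝[>] 0) (𝓝 0) := by
    have : Continuous fun t : ℝ => 1 / y * ‖t * Real.log t‖ :=
      (Real.continuous_mul_log.norm).const_mul _
    simpa using (this.tendsto 0).mono_left nhdsWithin_le_nhds
  refine squeeze_zero_norm' ?_ log_mul_tendsto
  filter_upwards [self_mem_nhdsWithin] with t ht
  have t_pos : 0 < t := ht
  have exp_le := exp_neg_sub_div_mul_rpow_le hy t_pos 1 1
  simp only [sub_self, Real.rpow_zero, mul_one, Nat.factorial_one, Nat.cast_one, pow_one,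
    add_sub_cancel_right, Real.rpow_one] at exp_le
  rw [norm_mul, norm_mul, Real.norm_of_nonneg (Real.exp_pos _).le, Real.norm_of_nonneg t_pos.le]
  calc ‖Real.log t‖ * Real.exp (-t - y / t) ≤ ‖Real.log t‖ * (1 / y * (1 * t)) := by
        gcongr
        refine exp_le.trans ?_
        gcongr
        exact Real.exp_le_one_iff.2 (by linarith)
    _ = 1 / y * (t * ‖Real.log t‖) := by ring

/-- This is the `s`-derivative at `s = 0` of the recursion `s M_s = M_{s+1} - y M_{s-1}` for
`M_s = macdonald s y`. -/
lemma macdonald_zero_eq_macdonaldLog {y : ℝ} (hy : 0 < y) :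
    macdonald 0 y = macdonaldLog 1 y - y * macdonaldLog (-1) y := by
  have hM := integrableOn_exp_neg_sub_div_mul_rpow hy 0
  have hL := integrableOn_log_mul_exp_neg_sub_div_mul_rpow hy 1
  have hL' := (integrableOn_log_mul_exp_neg_sub_div_mul_rpow hy (-1)).const_mul y
  have hasDeriv (t : ℝ) (ht : t ∈ Ioi 0) :
      HasDerivAt (fun t => Real.log t * Real.exp (-t - y / t))
        (Real.exp (-t - y / t) * t ^ (0 - 1 : ℝ) -
          Real.log t * (Real.exp (-t - y / t) * t ^ (1 - 1 : ℝ)) +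
          y * (Real.log t * (Real.exp (-t - y / t) * t ^ (-1 - 1 : ℝ)))) t := by
    have t_pos : 0 < t := ht
    have deriv_exponent : HasDerivAt (fun t : ℝ => -t - y / t) (-1 - y * (-(t ^ 2)⁻¹)) t :=
      (hasDerivAt_id t).neg.sub ((hasDerivAt_inv t_pos.ne').const_mul y)
    refine ((Real.hasDerivAt_log t_pos.ne').mul deriv_exponent.exp).congr_deriv ?_
    rw [zero_sub, sub_self, Real.rpow_sub_one t_pos.ne', Real.rpow_neg_one, Real.rpow_zero]
    field_simp
    ring
  have hML : IntegrableOn (fun t => Real.exp (-t - y / t) * t ^ (0 - 1 : ℝ) -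
      Real.log t * (Real.exp (-t - y / t) * t ^ (1 - 1 : ℝ))) (Ioi 0) := hM.sub hL
  have integrable_deriv := hML.add hL'
  have integrable_fun : IntegrableOn (fun t => Real.log t * Real.exp (-t - y / t)) (Ioi 0) := by
    simpa using hL
  have continuousWithin : ContinuousWithinAt (fun t => Real.log t * Real.exp (-t - y / t))
      (Ici 0) 0 := by
    rw [← continuousWithinAt_Ioi_iff_Ici, ContinuousWithinAt, Real.log_zero, zero_mul]
    exact tendsto_log_mul_exp_neg_sub_div hy
  have by_parts := integral_Ioi_of_hasDerivAt_of_tendsto continuousWithin hasDeriv integrable_deriv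
    (tendsto_zero_of_hasDerivAt_of_integrableOn_Ioi hasDeriv integrable_deriv integrable_fun)
  rw [integral_add hML hL', integral_sub hM hL, integral_const_mul, Real.log_zero, zero_mul,
    sub_zero] at by_parts
  rw [macdonald, macdonaldLog, macdonaldLog]
  linarith

lemma macdonald_zero_eq {y : ℝ} (hy : 0 < y) :
    macdonald 0 y = 2 * macdonaldLog 1 y - Real.log y * macdonald 1 y := by
  have reflection := rpow_mul_macdonaldLog_neg 1 hy
  rw [Real.rpow_one] at reflection
  rw [macdonald_zero_eq_macdonaldLog hy, reflection]
  ring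

lemma one_sub_exp_neg_le_sqrt {x : ℝ} (hx : 0 ≤ x) : 1 - Real.exp (-x) ≤ √x := by
  rcases le_total x 1 with h | h
  · have le_sqrt : x ≤ √x := Real.le_sqrt_of_sq_le (by nlinarith)
    linarith [Real.add_one_le_exp (-x)]
  · linarith [Real.one_le_sqrt.2 h, Real.exp_pos (-x)]

lemma abs_exp_neg_sub_div_sub_le {y t : ℝ} (hy : 0 ≤ y) (ht : 0 < t) :
    |Real.exp (-t - y / t) - Real.exp (-t)| ≤ √y * (Real.exp (-t) * t ^ (-(1 / 2) : ℝ)) := by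
  have div_nonneg : 0 ≤ y / t := by positivity
  have one_sub_le := one_sub_exp_neg_le_sqrt div_nonneg
  rw [Real.sqrt_div hy] at one_sub_le
  have exp_le : Real.exp (-t - y / t) ≤ Real.exp (-t) := Real.exp_le_exp.2 (by linarith)
  rw [abs_sub_comm, abs_of_nonneg (sub_nonneg.2 exp_le), sub_eq_add_neg (-t), Real.exp_add,
    Real.rpow_neg ht.le, ← Real.sqrt_eq_rpow]
  calc Real.exp (-t) - Real.exp (-t) * Real.exp (-(y / t))
      = Real.exp (-t) * (1 - Real.exp (-(y / t))) := by ring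
    _ ≤ Real.exp (-t) * (√y / √t) := by gcongr
    _ = √y * (Real.exp (-t) * (√t)⁻¹) := by ring

lemma abs_macdonald_sub_Gamma_le {s y : ℝ} (hs : 1 / 2 < s) (hy : 0 < y) :
    |macdonald s y - Real.Gamma s| ≤ √y * Real.Gamma (s - 1 / 2) := by
  have s_pos : 0 < s := by linarith
  have sub_pos : 0 < s - 1 / 2 := by linarith
  rw [Real.Gamma_eq_integral s_pos, Real.Gamma_eq_integral sub_pos, macdonald,
    ← integral_sub (integrableOn_exp_neg_sub_div_mul_rpow hy s)
      (Real.GammaIntegral_convergent s_pos), ← integral_const_mul, ← Real.norm_eq_abs]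
  refine norm_integral_le_of_norm_le ((Real.GammaIntegral_convergent sub_pos).const_mul _) ?_
  filter_upwards [ae_restrict_mem measurableSet_Ioi] with t ht
  have t_pos : 0 < t := ht
  rw [← sub_mul, norm_mul, Real.norm_of_nonneg (by positivity : 0 ≤ t ^ (s - 1)), Real.norm_eq_abs]
  calc |Real.exp (-t - y / t) - Real.exp (-t)| * t ^ (s - 1)
      ≤ √y * (Real.exp (-t) * t ^ (-(1 / 2) : ℝ)) * t ^ (s - 1) := by
        gcongr
        exact abs_exp_neg_sub_div_sub_le hy.le t_pos
    _ = √y * (Real.exp (-t) * t ^ (s - 1 / 2 - 1)) := by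
        rw [show s - 1 / 2 - 1 = -(1 / 2) + (s - 1) by ring, Real.rpow_add t_pos]
        ring

lemma integral_log_mul_exp_neg : ∫ t in Ioi (0 : ℝ), Real.log t * Real.exp (-t) = -γ := by
  have deriv_integral := Complex.hasDerivAt_GammaIntegral (s := 1) (by simp)
  have deriv_Gamma : HasDerivAt Complex.GammaIntegral (-(γ : ℂ)) 1 := by
    refine Complex.hasDerivAt_Gamma_one.congr_of_eventuallyEq ?_
    filter_upwards [(isOpen_lt continuous_const Complex.continuous_re).mem_nhds
      (show (0 : ℝ) < (1 : ℂ).re by simp)] with s hs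
    exact (Complex.Gamma_eq_integral hs).symm
  rw [← Complex.ofReal_inj, ← integral_complex_ofReal, Complex.ofReal_neg,
    ← deriv_integral.unique deriv_Gamma]
  exact setIntegral_congr_fun measurableSet_Ioi fun t _ => by simp

lemma integrableOn_log_mul_exp_neg :
    IntegrableOn (fun t : ℝ => Real.log t * Real.exp (-t)) (Ioi 0) := by
  simpa using integrableOn_log_mul_mul_rpow (f := fun t => Real.exp (-t)) (s := 1)
    (Real.GammaIntegral_convergent (by norm_num)) (Real.GammaIntegral_convergent (by norm_num))
    (by fun_prop)

lemma abs_macdonaldLog_one_add_le {y : ℝ} (hy : 0 < y) :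
    |macdonaldLog 1 y + γ| ≤ √y * (4 * (Real.Gamma (3 / 4) + Real.Gamma (1 / 4))) := by
  have integrable_add := Real.GammaIntegral_convergent (s := 3 / 4) (by norm_num)
  have integrable_sub := Real.GammaIntegral_convergent (s := 1 / 4) (by norm_num)
  have integral_eq : macdonaldLog 1 y + γ = ∫ t in Ioi (0 : ℝ),
      (Real.log t * (Real.exp (-t - y / t) * t ^ (1 - 1 : ℝ)) - Real.log t * Real.exp (-t)) := by
    rw [integral_sub (integrableOn_log_mul_exp_neg_sub_div_mul_rpow hy 1)
      integrableOn_log_mul_exp_neg, integral_log_mul_exp_neg, macdonaldLog, sub_neg_eq_add]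
  rw [integral_eq, Real.Gamma_eq_integral (by norm_num), Real.Gamma_eq_integral (by norm_num),
    ← integral_add integrable_add integrable_sub, ← integral_const_mul, ← integral_const_mul,
    ← Real.norm_eq_abs]
  refine norm_integral_le_of_norm_le (((integrable_add.add integrable_sub).const_mul _).const_mul _)
    ?_
  filter_upwards [ae_restrict_mem measurableSet_Ioi] with t ht
  have t_pos : 0 < t := ht
  have log_mul_rpow_le := abs_log_mul_rpow_le t_pos (1 / 2)
  norm_num only at log_mul_rpow_le ⊢
  rw [Real.rpow_zero, mul_one, ← mul_sub, norm_mul, Real.norm_eq_abs, Real.norm_eq_abs]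
  calc |Real.log t| * |Real.exp (-t - y / t) - Real.exp (-t)|
      ≤ |Real.log t| * (√y * (Real.exp (-t) * t ^ (-(1 / 2) : ℝ))) := by
        gcongr
        exact abs_exp_neg_sub_div_sub_le hy.le t_pos
    _ = √y * (Real.exp (-t) * (|Real.log t| * t ^ (-(1 / 2) : ℝ))) := by ring
    _ ≤ √y * (Real.exp (-t) * (4 * (t ^ (-(1 / 4) : ℝ) + t ^ (-(3 / 4) : ℝ)))) :=
        mul_le_mul_of_nonneg_left (mul_le_mul_of_nonneg_left log_mul_rpow_le (Real.exp_pos _).le)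
          (Real.sqrt_nonneg y)
    _ = √y * (4 * (Real.exp (-t) * t ^ (-(1 / 4) : ℝ) + Real.exp (-t) * t ^ (-(3 / 4) : ℝ))) := by
        ring

lemma isBigO_macdonald_one_sub_one :
    (fun y => macdonald 1 y - 1) =O[𝓝[>] 0] fun y : ℝ => √y := by
  refine .of_bound (Real.Gamma (1 - 1 / 2)) ?_
  filter_upwards [self_mem_nhdsWithin] with y hy
  have := abs_macdonald_sub_Gamma_le (s := 1) (by norm_num) hy
  rwa [Real.Gamma_one, mul_comm, ← Real.norm_eq_abs, ← Real.norm_of_nonneg (Real.sqrt_nonneg y)]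
    at this

lemma isLittleO_const_log (c : ℝ) : (fun _ => c) =o[𝓝[>] 0] Real.log :=
  isLittleO_const_left.2 <| .inr <| tendsto_abs_atBot_atTop.comp Real.tendsto_log_nhdsGT_zero

lemma isBigO_macdonald_zero_add_log_add :
    (fun y => macdonald 0 y + Real.log y + 2 * γ) =O[𝓝[>] 0] fun y => √y * Real.log y := by
  have isBigO_macdonaldLog :
      (fun y => 2 * (macdonaldLog 1 y + γ)) =O[𝓝[>] 0] fun y => √y * Real.log y := by
    have isBigO_sqrt : (fun y => macdonaldLog 1 y + γ) =O[𝓝[>] 0] fun y : ℝ => √y := by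
      refine .of_bound (4 * (Real.Gamma (3 / 4) + Real.Gamma (1 / 4))) ?_
      filter_upwards [self_mem_nhdsWithin] with y hy
      rw [Real.norm_eq_abs, Real.norm_of_nonneg (Real.sqrt_nonneg y), mul_comm]
      exact abs_macdonaldLog_one_add_le hy
    simpa only [mul_comm] using isBigO_sqrt.mul (isLittleO_const_log 2).isBigO
  refine (isBigO_macdonaldLog.sub
    (isBigO_macdonald_one_sub_one.mul (isBigO_refl Real.log _))).congr' ?_ EventuallyEq.rfl
  filter_upwards [self_mem_nhdsWithin] with y hy
  rw [macdonald_zero_eq hy]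
  ring

/-! ### Radial functions on the plane -/

lemma measurable_norm_sq : Measurable (fun x : ℂ => ‖x‖ ^ 2) := by fun_prop

lemma ofReal_pi_ne_zero : ENNReal.ofReal Real.pi ≠ 0 :=
  (ENNReal.ofReal_pos.2 Real.pi_pos).ne'

lemma volume_norm_sq_preimage_Iic (b : ℝ) :
    volume ((fun x : ℂ => ‖x‖ ^ 2) ⁻¹' Iic b) = ENNReal.ofReal Real.pi * ENNReal.ofReal b := by
  rcases lt_or_ge b 0 with hb | hb
  · have empty : (fun x : ℂ => ‖x‖ ^ 2) ⁻¹' Iic b = ∅ :=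
      eq_empty_of_forall_notMem fun x hx => (hb.trans_le (sq_nonneg ‖x‖)).not_ge hx
    rw [empty, ENNReal.ofReal_of_nonpos hb.le, measure_empty, mul_zero]
  · have disc : (fun x : ℂ => ‖x‖ ^ 2) ⁻¹' Iic b = Metric.closedBall 0 (√b) := by
      ext x
      simpa only [mem_preimage, mem_Iic, mem_closedBall_zero_iff] using
        (Real.le_sqrt (norm_nonneg _) hb).symm
    rw [disc, Complex.volume_closedBall, ← ENNReal.ofReal_pow (Real.sqrt_nonneg _),
      Real.sq_sqrt hb, mul_comm, ← NNReal.coe_real_pi, ENNReal.ofReal_coe_nnreal]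

lemma map_norm_sq_volume :
    Measure.map (fun x : ℂ => ‖x‖ ^ 2) volume =
      ENNReal.ofReal Real.pi • (volume : Measure ℝ).restrict (Ioi 0) := by
  have map_Iic (b : ℝ) : Measure.map (fun x : ℂ => ‖x‖ ^ 2) volume (Iic b) =
      ENNReal.ofReal Real.pi * ENNReal.ofReal b := by
    rw [Measure.map_apply measurable_norm_sq measurableSet_Iic, volume_norm_sq_preimage_Iic]
  have smul_Iic (b : ℝ) : (ENNReal.ofReal Real.pi • (volume : Measure ℝ).restrict (Ioi 0))
      (Iic b) = ENNReal.ofReal Real.pi * ENNReal.ofReal b := by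
    rw [Measure.smul_apply, Measure.restrict_apply measurableSet_Iic, smul_eq_mul,
      inter_comm, Ioi_inter_Iic, Real.volume_Ioc, sub_zero]
  have ne_top (b : ℝ) : ENNReal.ofReal Real.pi * ENNReal.ofReal b ≠ ⊤ :=
    ENNReal.mul_ne_top ENNReal.ofReal_ne_top ENNReal.ofReal_ne_top
  refine Measure.ext_of_Ioc' _ _ (fun a b _ => ?_) fun a b hab => ?_
  · exact ne_top_of_le_ne_top (map_Iic b ▸ ne_top b) (measure_mono Ioc_subset_Iic_self)
  · have subset : Iic a ⊆ Iic b := Iic_subset_Iic.2 hab.le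
    rw [← Iic_sdiff_Iic,
      measure_sdiff subset measurableSet_Iic.nullMeasurableSet (map_Iic a ▸ ne_top a),
      measure_sdiff subset measurableSet_Iic.nullMeasurableSet (smul_Iic a ▸ ne_top a),
      map_Iic, map_Iic, smul_Iic, smul_Iic]

lemma ae_norm_sq_of_ae {P : ℝ → Prop} (h : ∀ᵐ s : ℝ, 0 < s → P s) : ∀ᵐ x : ℂ, P (‖x‖ ^ 2) := by
  refine ae_of_ae_map (p := P) measurable_norm_sq.aemeasurable ?_
  rw [map_norm_sq_volume]
  exact Measure.ae_smul_measure ((ae_restrict_iff' measurableSet_Ioi).2 h) _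

lemma integral_comp_norm_sq {G : ℝ → ℂ} (hG : AEStronglyMeasurable G (volume.restrict (Ioi 0))) :
    ∫ x : ℂ, G (‖x‖ ^ 2) = Real.pi * ∫ s in Ioi (0 : ℝ), G s := by
  rw [← integral_map (φ := fun x : ℂ => ‖x‖ ^ 2) measurable_norm_sq.aemeasurable,
    map_norm_sq_volume, integral_smul_measure, ENNReal.toReal_ofReal Real.pi_pos.le,
    Complex.real_smul]
  rw [map_norm_sq_volume]
  exact hG.smul_measure _

lemma integrable_comp_norm_sq_iff {G : ℝ → ℂ}
    (hG : AEStronglyMeasurable G (volume.restrict (Ioi 0))) :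
    Integrable (fun x : ℂ => G (‖x‖ ^ 2)) ↔ IntegrableOn G (Ioi 0) := by
  have map_iff := integrable_map_measure (μ := (volume : Measure ℂ)) (f := fun x : ℂ => ‖x‖ ^ 2)
    (g := G) (by rw [map_norm_sq_volume]; exact hG.smul_measure _) measurable_norm_sq.aemeasurable
  rw [map_norm_sq_volume, integrable_smul_measure ofReal_pi_ne_zero ENNReal.ofReal_ne_top]
    at map_iff
  exact map_iff.symm

lemma volume_eq_zero_iff_ae_polarCoord {N : Set ℂ} (hN : MeasurableSet N) :
    volume N = 0 ↔ ∀ᵐ p ∂(volume : Measure (ℝ × ℝ)).restrict polarCoord.target,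
      Complex.polarCoord.symm p ∉ N := by
  have measurable_symm : Measurable fun p : ℝ × ℝ => Complex.polarCoord.symm p := by
    simp only [Complex.polarCoord_symm_apply]
    fun_prop
  have measurable_integrand : Measurable fun p : ℝ × ℝ =>
      ENNReal.ofReal p.1 • N.indicator (1 : ℂ → ENNReal) (Complex.polarCoord.symm p) :=
    measurable_fst.ennreal_ofReal.smul ((measurable_one.indicator hN).comp measurable_symm)
  rw [← lintegral_indicator_one hN, ← Complex.lintegral_comp_polarCoord_symm,
    lintegral_eq_zero_iff measurable_integrand]
  refine Filter.eventually_congr ?_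
  filter_upwards [ae_restrict_mem polarCoord.open_target.measurableSet] with p hp
  have r_pos : 0 < p.1 := hp.1
  simp [r_pos]

lemma ae_ae_polarCoord_of_ae {P : ℂ → Prop} (h : ∀ᵐ x : ℂ, P x) :
    ∀ᵐ (r : ℝ) ∂(volume.restrict (Ioi (0 : ℝ))),
      ∀ᵐ (θ : ℝ) ∂(volume.restrict (Ioo (-Real.pi) Real.pi)),
        P (r * Complex.exp (θ * Complex.I)) := by
  obtain ⟨N, subset, measurable, null⟩ := exists_measurable_superset_of_null (ae_iff.1 h)
  have polar := (volume_eq_zero_iff_ae_polarCoord measurable).1 null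
  rw [polarCoord_target, Measure.volume_eq_prod, ← Measure.prod_restrict] at polar
  filter_upwards [Measure.ae_ae_of_ae_prod polar] with r hr
  filter_upwards [hr] with θ hθ
  simpa [Complex.exp_mul_I] using not_not.1 (notMem_subset subset hθ)

lemma ae_comp_norm_of_ae {P : ℝ → Prop} (h : ∀ᵐ r : ℝ, 0 < r → P r) : ∀ᵐ x : ℂ, P ‖x‖ := by
  obtain ⟨N, subset, measurable, null⟩ := exists_measurable_superset_of_null (ae_iff.1 h)
  have fst_notMem : ∀ᵐ p : ℝ × ℝ, p.1 ∉ N :=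
    Measure.quasiMeasurePreserving_fst.ae (measure_eq_zero_iff_ae_notMem.1 null)
  have preimage_null : volume ((fun x : ℂ => ‖x‖) ⁻¹' N) = 0 := by
    refine (volume_eq_zero_iff_ae_polarCoord (measurable.preimage measurable_norm)).2 ?_
    filter_upwards [ae_restrict_of_ae fst_notMem,
      ae_restrict_mem polarCoord.open_target.measurableSet] with p hp target
    rwa [mem_preimage, Complex.norm_polarCoord_symm, abs_of_pos target.1]
  filter_upwards [measure_eq_zero_iff_ae_notMem.1 preimage_null, Measure.ae_ne volume 0]
    with x hx x_ne
  exact not_not.1 (notMem_subset subset hx) (norm_pos_iff.2 x_ne)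

/-- The mean of `v` over the circle of radius `r` about the origin. -/
def circleMean (v : ℂ → ℂ) (r : ℝ) : ℂ :=
  ⨍ θ in Ioo (-Real.pi) Real.pi, v (r * Complex.exp (θ * Complex.I))

lemma stronglyMeasurable_circleMean {v : ℂ → ℂ} (hv : StronglyMeasurable v) :
    StronglyMeasurable (circleMean v) := by
  unfold circleMean
  simp only [setAverage_eq]
  refine StronglyMeasurable.const_smul ?_ _
  exact StronglyMeasurable.integral_prod_right (f := fun (r : ℝ) (θ : ℝ) =>
    v (r * Complex.exp (θ * Complex.I))) (hv.comp_measurable (by fun_prop))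

lemma ae_circleMean_eq {v : ℂ → ℂ} {f : ℝ → ℂ} (hv : ∀ᵐ x : ℂ, v x = f ‖x‖) :
    ∀ᵐ r : ℝ, 0 < r → circleMean v r = f r := by
  refine (ae_restrict_iff' measurableSet_Ioi).1 ?_
  filter_upwards [ae_ae_polarCoord_of_ae hv, ae_restrict_mem measurableSet_Ioi] with r hr r_pos
  have eq_const : (fun θ : ℝ => v (r * Complex.exp (θ * Complex.I)))
      =ᵐ[volume.restrict (Ioo (-Real.pi) Real.pi)] fun _ => f r := by
    filter_upwards [hr] with θ hθ
    simpa [abs_of_pos (mem_Ioi.1 r_pos)] using hθ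
  rw [circleMean, average_congr eq_const, setAverage_const]
  · simp [Real.pi_pos]
  · exact measure_Ioo_lt_top.ne

lemma IsRadial.exists_stronglyMeasurable {u : ℂ → ℂ} (hu : IsRadial u)
    (hm : AEStronglyMeasurable u) :
    ∃ F : ℝ → ℂ, StronglyMeasurable F ∧ ∀ᵐ x : ℂ, u x = F (‖x‖ ^ 2) := by
  obtain ⟨f, hf⟩ := hu
  have mk_eq : ∀ᵐ x : ℂ, hm.mk u x = f ‖x‖ := by
    filter_upwards [hf, hm.ae_eq_mk] with x hx hmk
    rw [← hmk, hx]
  refine ⟨fun s => circleMean (hm.mk u) √s,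
    (stronglyMeasurable_circleMean hm.stronglyMeasurable_mk).comp_measurable
      Real.continuous_sqrt.measurable, ?_⟩
  filter_upwards [ae_comp_norm_of_ae (ae_circleMean_eq mk_eq), hf] with x hmean hx
  rw [Real.sqrt_sq (norm_nonneg x), hmean, hx]

lemma hasFDerivAt_comp_norm_sq {g : ℝ → ℂ} (hg : Differentiable ℝ g) (x : ℂ) :
    HasFDerivAt (fun x : ℂ => g (‖x‖ ^ 2))
      ((2 * deriv g (‖x‖ ^ 2)) • Complex.ofRealCLM.comp (innerSL ℝ x)) x := by
  refine ((hg (‖x‖ ^ 2)).hasDerivAt.hasFDerivAt.comp x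
    (hasStrictFDerivAt_norm_sq x).hasFDerivAt).congr_fderiv ?_
  ext v
  all_goals
    simp
    ring

lemma fderiv_fderiv_comp_norm_sq {g : ℝ → ℂ} (hg : ContDiff ℝ 2 g) (x v : ℂ) :
    fderiv ℝ (fderiv ℝ (fun x : ℂ => g (‖x‖ ^ 2))) x v v =
      2 * ‖v‖ ^ 2 * deriv g (‖x‖ ^ 2) + (2 * inner ℝ x v) ^ 2 * deriv (deriv g) (‖x‖ ^ 2) := by
  have differentiable_g : Differentiable ℝ g := hg.differentiable (by norm_num)
  have differentiable_deriv : Differentiable ℝ (deriv g) := hg.differentiable_deriv_two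
  have fderiv_apply : (fun z => fderiv ℝ (fun x : ℂ => g (‖x‖ ^ 2)) z v) =
      fun z : ℂ => 2 * (deriv g (‖z‖ ^ 2) * Complex.ofRealCLM (innerSL ℝ v z)) := by
    funext z
    rw [(hasFDerivAt_comp_norm_sq differentiable_g z).fderiv]
    simp [real_inner_comm, mul_assoc]
  have differentiable_fderiv : DifferentiableAt ℝ (fderiv ℝ (fun x : ℂ => g (‖x‖ ^ 2))) x :=
    ((hg.comp (contDiff_norm_sq ℝ)).fderiv_right (m := 1) (by norm_num)).differentiable
      (by norm_num) x
  have eval_comm : fderiv ℝ (fderiv ℝ (fun x : ℂ => g (‖x‖ ^ 2))) x v v =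
      fderiv ℝ (fun z => fderiv ℝ (fun x : ℂ => g (‖x‖ ^ 2)) z v) x v := by
    rw [fderiv_clm_apply differentiable_fderiv (differentiableAt_const v)]
    simp
  have hasFDerivAt_apply :=
    ((hasFDerivAt_comp_norm_sq differentiable_deriv x).fun_mul
      (Complex.ofRealCLM.comp (innerSL ℝ v)).hasFDerivAt).const_mul 2
  rw [eval_comm, fderiv_apply]
  refine (congrArg (· v) hasFDerivAt_apply.fderiv).trans ?_
  simp [real_inner_comm]
  ring

lemma laplacian_comp_norm_sq {g : ℝ → ℂ} (hg : ContDiff ℝ 2 g) (x : ℂ) :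
    Laplacian.laplacian (fun x : ℂ => g (‖x‖ ^ 2)) x =
      4 * (‖x‖ ^ 2 : ℝ) * deriv (deriv g) (‖x‖ ^ 2) + 4 * deriv g (‖x‖ ^ 2) := by
  have norm_sq : ((‖x‖ ^ 2 : ℝ) : ℂ) = x.re ^ 2 + x.im ^ 2 := by
    rw [← Complex.normSq_eq_norm_sq, Complex.normSq_apply]
    push_cast
    ring
  rw [InnerProductSpace.laplacian_eq_iteratedFDeriv_complexPlane]
  simp only [iteratedFDeriv_two_apply, Matrix.cons_val_zero, Matrix.cons_val_one]
  rw [fderiv_fderiv_comp_norm_sq hg, fderiv_fderiv_comp_norm_sq hg, norm_sq]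
  simp [Complex.inner]
  ring

/-! ### Distributional equations on the line -/

lemma exists_pos_subset_Icc {K : Set ℝ} (hK : IsCompact K) (h : K ⊆ Ioi 0) :
    ∃ a b : ℝ, 0 < a ∧ K ⊆ Icc a b := by
  rcases K.eq_empty_or_nonempty with rfl | nonempty
  · exact ⟨1, 1, one_pos, empty_subset _⟩
  · obtain ⟨a, ha⟩ := hK.exists_isLeast nonempty
    obtain ⟨b, hb⟩ := hK.bddAbove
    exact ⟨a, b, h ha.1, fun s hs => ⟨ha.2 hs, hb hs⟩⟩

lemma exists_contDiff_integral_eq_one {a b : ℝ} (hab : a < b) :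
    ∃ p : ℝ → ℝ, ContDiff ℝ ∞ p ∧ tsupport p ⊆ Icc a b ∧ ∫ s, p s = 1 := by
  let bump : ContDiffBump ((a + b) / 2) := ⟨(b - a) / 4, (b - a) / 2, by linarith, by linarith⟩
  refine ⟨bump.normed volume, bump.contDiff_normed, ?_, bump.integral_normed⟩
  rw [bump.tsupport_normed_eq, Real.closedBall_eq_Icc]
  exact Icc_subset_Icc (by simp only [bump]; linarith) (by simp only [bump]; linarith)

lemma hasCompactSupport_of_tsupport_subset_Icc {g : ℝ → ℝ} {a b : ℝ} (h : tsupport g ⊆ Icc a b) :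
    HasCompactSupport g :=
  isCompact_Icc.of_isClosed_subset (isClosed_tsupport g) h

lemma exists_compactlySupported_primitive {p : ℝ → ℝ} (hp : ContDiff ℝ ∞ p) {a b : ℝ}
    (hsupp : tsupport p ⊆ Icc a b) (integral_eq : ∫ s, p s = 0) :
    ∃ g : ℝ → ℝ, ContDiff ℝ ∞ g ∧ tsupport g ⊆ Icc a b ∧ deriv g = p := by
  have hasDerivAt (s : ℝ) : HasDerivAt (fun s => ∫ t in (a - 1)..s, p t) (p s) s :=
    hp.continuous.integral_hasStrictDerivAt _ s |>.hasDerivAt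
  have deriv_eq : deriv (fun s => ∫ t in (a - 1)..s, p t) = p :=
    funext fun s => (hasDerivAt s).deriv
  refine ⟨fun s => ∫ t in (a - 1)..s, p t, ?_,
    closure_minimal (Function.support_subset_iff'.2 fun s hs => ?_) isClosed_Icc, deriv_eq⟩
  · exact contDiff_infty_iff_deriv.2
      ⟨fun s => (hasDerivAt s).differentiableAt, deriv_eq.symm ▸ hp⟩
  · rcases lt_or_ge s a with s_lt | le_s
    · refine intervalIntegral.integral_zero_ae (Eventually.of_forall fun t ht =>
        image_eq_zero_of_notMem_tsupport fun mem => ?_)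
      exact (ht.2.trans_lt (max_lt (sub_one_lt a) s_lt)).not_ge (hsupp mem).1
    · have lt_s : b < s := not_le.1 fun s_le => hs ⟨le_s, s_le⟩
      rw [← integral_eq]
      refine intervalIntegral.integral_eq_integral_of_support_subset fun t ht => ?_
      have mem := hsupp (subset_tsupport p ht)
      exact ⟨(sub_one_lt a).trans_le mem.1, mem.2.trans lt_s.le⟩

lemma exists_primitive_sub_integral_mul {p p₀ : ℝ → ℝ} (hp : ContDiff ℝ ∞ p)
    (hp₀ : ContDiff ℝ ∞ p₀) {a b : ℝ} (hsupp : tsupport p ⊆ Icc a b)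
    (hsupp₀ : tsupport p₀ ⊆ Icc a b) (integral_eq : ∫ s, p₀ s = 1) :
    ∃ g : ℝ → ℝ, ContDiff ℝ ∞ g ∧ tsupport g ⊆ Icc a b ∧
      deriv g = fun s => p s - (∫ t, p t) * p₀ s := by
  have integrable {q : ℝ → ℝ} (hq : ContDiff ℝ ∞ q) (h : tsupport q ⊆ Icc a b) :
      Integrable q :=
    hq.continuous.integrable_of_hasCompactSupport (hasCompactSupport_of_tsupport_subset_Icc h)
  refine exists_compactlySupported_primitive (hp.sub (contDiff_const.mul hp₀))
    (closure_minimal (Function.support_subset_iff'.2 fun s hs => ?_) isClosed_Icc) ?_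
  · rw [image_eq_zero_of_notMem_tsupport fun mem => hs (hsupp mem),
      image_eq_zero_of_notMem_tsupport fun mem => hs (hsupp₀ mem), mul_zero, sub_zero]
  · rw [integral_sub (integrable hp hsupp) ((integrable hp₀ hsupp₀).const_mul _),
      integral_const_mul, integral_eq, mul_one, sub_self]

lemma contDiff_inv_mul_of_tsupport_subset {P : ℝ → ℝ} (hP : ContDiff ℝ ∞ P)
    (hsupp : tsupport P ⊆ Ioi 0) : ContDiff ℝ ∞ fun s => s⁻¹ * P s := by
  refine contDiff_iff_contDiffAt.2 fun s => ?_
  by_cases hs : s ∈ tsupport P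
  · exact (contDiffAt_inv ℝ (hsupp hs).ne').mul hP.contDiffAt
  · refine contDiffAt_const (c := 0) |>.congr_of_eventuallyEq ?_
    filter_upwards [notMem_tsupport_iff_eventuallyEq.1 hs] with t ht
    rw [ht, Pi.zero_apply, mul_zero]

section

variable {E : Type*} [NormedAddCommGroup E]

lemma intervalIntegrable_of_locallyIntegrable {B : ℝ → E} (hB : LocallyIntegrable B) (a b : ℝ) :
    IntervalIntegrable B volume a b :=
  (hB.integrableOn_isCompact isCompact_uIcc).intervalIntegrable

variable [NormedSpace ℝ E]

lemma continuous_primitive_of_locallyIntegrable {B : ℝ → E} (hB : LocallyIntegrable B) (c : ℝ) :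
    Continuous fun s => ∫ t in c..s, B t :=
  intervalIntegral.continuous_primitive
    (fun _ _ => intervalIntegrable_of_locallyIntegrable hB _ _) c

lemma continuousOn_inv_smul_primitive {B : ℝ → E} (hB : LocallyIntegrable B) :
    ContinuousOn (fun s : ℝ => (4 * s)⁻¹ • ∫ t in (0 : ℝ)..s, B t) (Ioi 0) :=
  (ContinuousOn.inv₀ (by fun_prop) fun s hs => by simpa using (mem_Ioi.1 hs).ne').smul
    (continuous_primitive_of_locallyIntegrable hB 0).continuousOn

lemma integrable_smul_of_tsupport_subset {U : Set ℝ} {f : ℝ → E} (hf : LocallyIntegrableOn f U)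
    {g : ℝ → ℝ} (hg : Continuous g) (hc : HasCompactSupport g) (hsupp : tsupport g ⊆ U) :
    Integrable fun s => g s • f s := by
  refine (integrableOn_iff_integrable_of_support_subset (s := tsupport g) ?_).1
    ((hf.integrableOn_compact_subset hsupp hc.isCompact).continuousOn_smul hg.continuousOn
      hc.isCompact)
  exact (Function.support_smul_subset_left _ _).trans (subset_tsupport g)

lemma integral_mul_eq_neg_integral_deriv_mul_primitive {B : ℝ → ℝ} {a b c : ℝ}
    (hB : IntervalIntegrable B volume a b) (hc : c ∈ uIcc a b) {g : ℝ → ℝ} (hg : ContDiff ℝ 1 g)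
    (hsupp : tsupport g ⊆ Ioo a b) :
    ∫ s, g s * B s = -∫ s, deriv g s * ∫ t in c..s, B t := by
  have support_subset {f : ℝ → ℝ} (hf : Function.support f ⊆ tsupport g) (h : ℝ → ℝ) :
      Function.support (fun s => f s * h s) ⊆ Ioc a b :=
    (Function.support_mul_subset_left _ _).trans ((hf.trans hsupp).trans Ioo_subset_Ioc_self)
  have by_parts := hg.contDiffOn.absolutelyContinuousOnInterval.integral_mul_deriv_eq_deriv_mul
    (hB.absolutelyContinuousOnInterval_intervalIntegral hc)
  rw [image_eq_zero_of_notMem_tsupport fun mem => right_notMem_Ioo (hsupp mem),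
    image_eq_zero_of_notMem_tsupport fun mem => left_notMem_Ioo (hsupp mem),
    zero_mul, zero_mul, sub_zero, zero_sub] at by_parts
  rw [← intervalIntegral.integral_eq_integral_of_support_subset
      (support_subset (subset_tsupport g) _),
    ← intervalIntegral.integral_eq_integral_of_support_subset
      (support_subset support_deriv_subset _), ← by_parts]
  refine intervalIntegral.integral_congr_ae ?_
  filter_upwards [hB.ae_hasDerivAt_integral] with s hs mem
  rw [(hs (uIoc_subset_uIcc mem) c hc).deriv]

variable [CompleteSpace E]

lemma integral_smul_eq_neg_integral_deriv_smul_primitive {B : ℝ → E} {a b c : ℝ}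
    (hB : IntervalIntegrable B volume a b) (hc : c ∈ uIcc a b) {g : ℝ → ℝ} (hg : ContDiff ℝ 1 g)
    (hsupp : tsupport g ⊆ Ioo a b) :
    ∫ s, g s • B s = -∫ s, deriv g s • ∫ t in c..s, B t := by
  have compact : HasCompactSupport g :=
    hasCompactSupport_of_tsupport_subset_Icc (hsupp.trans Ioo_subset_Icc_self)
  have integrable_left : Integrable fun s => g s • B s :=
    integrable_smul_of_tsupport_subset
      ((hB.1.mono_set Ioo_subset_Ioc_self).locallyIntegrableOn) hg.continuous compact hsupp
  have integrable_right : Integrable fun s => deriv g s • ∫ t in c..s, B t := by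
    refine integrable_smul_of_tsupport_subset (U := uIcc a b) ?_ (hg.continuous_deriv le_rfl)
      compact.deriv (tsupport_deriv_subset.trans
        (hsupp.trans (Ioo_subset_Icc_self.trans Icc_subset_uIcc)))
    exact (intervalIntegral.continuousOn_primitive_interval' hB hc).locallyIntegrableOn
      measurableSet_uIcc
  refine (SeparatingDual.eq_iff_forall_dual_eq (R := ℝ)).2 fun L => ?_
  rw [map_neg, ← L.integral_comp_comm integrable_left, ← L.integral_comp_comm integrable_right]
  simp only [map_smul, smul_eq_mul]
  rw [integral_mul_eq_neg_integral_deriv_mul_primitive (c := c)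
    ⟨L.integrable_comp hB.1, L.integrable_comp hB.2⟩ hc hg hsupp]
  congr 1
  refine integral_congr_ae (Eventually.of_forall fun s => ?_)
  by_cases hs : s ∈ tsupport g
  · have mem : s ∈ uIcc a b := Icc_subset_uIcc (Ioo_subset_Icc_self (hsupp hs))
    simp only [L.intervalIntegral_comp_comm (hB.mono_set (uIcc_subset_uIcc hc mem))]
  · simp only [Function.notMem_support.1 fun mem => hs (support_deriv_subset mem), zero_mul]

lemma ae_eq_const_of_integral_deriv_smul_eq_zero {f : ℝ → E} (hf : LocallyIntegrableOn f (Ioi 0))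
    (h : ∀ P : ℝ → ℝ, ContDiff ℝ ∞ P → HasCompactSupport P → tsupport P ⊆ Ioi 0 →
      ∫ s, deriv P s • f s = 0) :
    ∃ c : E, ∀ᵐ s : ℝ, 0 < s → f s = c := by
  obtain ⟨p₀, smooth₀, supp₀, integral₀⟩ := exists_contDiff_integral_eq_one one_lt_two
  have pos_of_mem {a b : ℝ} (ha : 0 < a) : Icc a b ⊆ Ioi 0 := fun s hs => ha.trans_le hs.1
  have integrable₀ : Integrable fun s => p₀ s • f s :=
    integrable_smul_of_tsupport_subset hf smooth₀.continuous
      (hasCompactSupport_of_tsupport_subset_Icc supp₀) (supp₀.trans (pos_of_mem one_pos))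
  refine ⟨∫ s, p₀ s • f s, ?_⟩
  suffices weak : ∀ g : ℝ → ℝ, ContDiff ℝ ∞ g → HasCompactSupport g → tsupport g ⊆ Ioi 0 →
      ∫ s, g s • (f s - ∫ t, p₀ t • f t) = 0 by
    filter_upwards [isOpen_Ioi.ae_eq_zero_of_integral_contDiff_smul_eq_zero
      (hf.sub (continuous_const.locallyIntegrable.locallyIntegrableOn _)) weak] with s hs s_pos
    exact sub_eq_zero.1 (hs s_pos)
  intro g smooth compact supp
  obtain ⟨a, b, a_pos, supp_Icc⟩ := exists_pos_subset_Icc compact.isCompact supp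
  obtain ⟨P, smooth_P, supp_P, deriv_P⟩ := exists_primitive_sub_integral_mul smooth smooth₀
    (supp_Icc.trans (Icc_subset_Icc (min_le_left a 1) (le_max_left b 2)))
    (supp₀.trans (Icc_subset_Icc (min_le_right a 1) (le_max_right b 2))) integral₀
  have integral_P := h P smooth_P (hasCompactSupport_of_tsupport_subset_Icc supp_P)
    (supp_P.trans (pos_of_mem (lt_min a_pos one_pos)))
  have integrable_g := integrable_smul_of_tsupport_subset hf smooth.continuous compact supp
  simp only [deriv_P, sub_smul, mul_smul] at integral_P
  rw [integral_sub integrable_g (integrable₀.fun_smul _), integral_smul] at integral_P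
  simp only [smul_sub]
  rwa [integral_sub integrable_g ((smooth.continuous.integrable_of_hasCompactSupport
    compact).smul_const _), integral_smul_const]

/-- The weak form of `4 (s F')' = B` on the line. -/
def IsWeakRadialSolution (F B : ℝ → E) : Prop :=
  ∀ g : ℝ → ℝ, ContDiff ℝ ∞ g → HasCompactSupport g →
    ∫ s, g s • B s = ∫ s, (4 * (s * deriv (deriv g) s + deriv g s)) • F s

variable {F B : ℝ → E} (hB : LocallyIntegrable B) (hF₀ : ∀ s ≤ 0, F s = 0)
  (hB₀ : ∀ s ≤ 0, B s = 0) (hw : IsWeakRadialSolution F B)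

include hB hF₀ hB₀ hw

-- `p` is made a derivative by a correction on the negative axis, where `F` and `B` vanish.
lemma integral_smul_primitive_eq_of_isWeakRadialSolution {p : ℝ → ℝ} (hp : ContDiff ℝ ∞ p)
    (hc : HasCompactSupport p) :
    ∫ s, p s • ∫ t in (0 : ℝ)..s, B t = -∫ s, (4 * (s * deriv p s + p s)) • F s := by
  obtain ⟨p₀, smooth₀, supp₀, integral₀⟩ :=
    exists_contDiff_integral_eq_one (show (-2 : ℝ) < -1 by norm_num)
  obtain ⟨a, b, supp⟩ := bddBelow_bddAbove_iff_subset_Icc.1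
    ⟨hc.isCompact.bddBelow, hc.isCompact.bddAbove⟩
  obtain ⟨g, smooth_g, supp_g, deriv_g⟩ := exists_primitive_sub_integral_mul hp smooth₀
    (supp.trans (Icc_subset_Icc (min_le_left a (-2)) (le_max_left b (-1))))
    (supp₀.trans (Icc_subset_Icc (min_le_right a (-2)) (le_max_right b (-1)))) integral₀
  have deriv_g_eventuallyEq {s : ℝ} (hs : 0 < s) : deriv g =ᶠ[𝓝 s] p := by
    filter_upwards [Ioi_mem_nhds hs] with t ht
    have notMem : t ∉ tsupport p₀ := fun mem => by linarith [(supp₀ mem).2, mem_Ioi.1 ht]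
    simp only [deriv_g, image_eq_zero_of_notMem_tsupport notMem, mul_zero, sub_zero]
  have primitive_eq_zero {s : ℝ} (hs : s ≤ 0) : ∫ t in (0 : ℝ)..s, B t = 0 :=
    intervalIntegral.integral_zero_ae (Eventually.of_forall fun t ht =>
      hB₀ t (ht.2.trans (max_le le_rfl hs)))
  have by_parts := integral_smul_eq_neg_integral_deriv_smul_primitive (c := 0)
    (intervalIntegrable_of_locallyIntegrable hB (min a (-2) - 1) (max b (-1) + 1))
    (Icc_subset_uIcc ⟨by linarith [min_le_right a (-2)], by linarith [le_max_right b (-1)]⟩)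
    (smooth_g.of_le (by norm_cast)) (supp_g.trans (Icc_subset_Ioo (by linarith) (by linarith)))
  rw [hw g smooth_g (hasCompactSupport_of_tsupport_subset_Icc supp_g)] at by_parts
  calc ∫ s, p s • ∫ t in (0 : ℝ)..s, B t
      = ∫ s, deriv g s • ∫ t in (0 : ℝ)..s, B t := by
        refine integral_congr_ae (Eventually.of_forall fun s => ?_)
        rcases le_or_gt s 0 with hs | hs
        · simp only [primitive_eq_zero hs, smul_zero]
        · simp only [(deriv_g_eventuallyEq hs).eq_of_nhds]
    _ = -∫ s, (4 * (s * deriv (deriv g) s + deriv g s)) • F s := by rw [by_parts, neg_neg]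
    _ = -∫ s, (4 * (s * deriv p s + p s)) • F s := by
        congr 1
        refine integral_congr_ae (Eventually.of_forall fun s => ?_)
        rcases le_or_gt s 0 with hs | hs
        · simp only [hF₀ s hs, smul_zero]
        · simp only [(deriv_g_eventuallyEq hs).eq_of_nhds, (deriv_g_eventuallyEq hs).deriv_eq]

lemma integral_deriv_smul_eq_of_isWeakRadialSolution {P : ℝ → ℝ} (hP : ContDiff ℝ ∞ P)
    (hc : HasCompactSupport P) (hsupp : tsupport P ⊆ Ioi 0) :
    ∫ s, deriv P s • F s =
      ∫ s, deriv P s • ∫ r in (1 : ℝ)..s, (4 * r)⁻¹ • ∫ t in (0 : ℝ)..r, B t := by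
  have first_order := integral_smul_primitive_eq_of_isWeakRadialSolution hB hF₀ hB₀ hw
    (contDiff_inv_mul_of_tsupport_subset hP hsupp) hc.mul_left
  have deriv_mul (s : ℝ) : (4 * (s * deriv (fun s => s⁻¹ * P s) s + s⁻¹ * P s)) • F s =
      (4 : ℝ) • (deriv P s • F s) := by
    rcases le_or_gt s 0 with hs | hs
    · rw [hF₀ s hs, smul_zero, smul_zero, smul_zero]
    · rw [((hasDerivAt_inv hs.ne').fun_mul (hP.differentiable (by simp) s).hasDerivAt).deriv,
        smul_smul]
      congr 1
      field_simp
      ring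
  obtain ⟨a, b, a_pos, supp_Icc⟩ := exists_pos_subset_Icc hc.isCompact hsupp
  have uIcc_subset : uIcc (min (a / 2) 1) (max (b + 1) 1) ⊆ Ioi 0 := fun s hs => by
    rw [uIcc_of_le ((min_le_right _ _).trans (le_max_right _ _))] at hs
    exact (lt_min (half_pos a_pos) one_pos).trans_le hs.1
  have by_parts := integral_smul_eq_neg_integral_deriv_smul_primitive (c := 1)
    ((continuousOn_inv_smul_primitive hB).mono uIcc_subset).intervalIntegrable
    (Icc_subset_uIcc ⟨min_le_right _ _, le_max_right _ _⟩) (hP.of_le (by norm_cast))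
    (supp_Icc.trans (Icc_subset_Ioo ((min_le_left _ _).trans_lt (half_lt_self a_pos))
      ((lt_add_one b).trans_le (le_max_left _ _))))
  have inv_mul_smul (s : ℝ) (v : E) : (s⁻¹ * P s) • v = (4 : ℝ) • (P s • (4 * s)⁻¹ • v) := by
    rw [smul_smul, smul_smul, mul_inv, mul_left_comm, mul_assoc]
    congr 1
    ring
  simp only [deriv_mul, inv_mul_smul, integral_smul] at first_order
  rw [by_parts, smul_neg, neg_inj] at first_order
  exact ((smul_right_injective E four_ne_zero) first_order).symm

lemma exists_ode_of_isWeakRadialSolution (hF : LocallyIntegrable F) :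
    ∃ G : ℝ → E, (∀ s, 0 < s → HasDerivAt G ((4 * s)⁻¹ • ∫ t in (0 : ℝ)..s, B t) s) ∧
      ∀ᵐ s : ℝ, 0 < s → F s = G s := by
  set T : ℝ → E := fun s => ∫ r in (1 : ℝ)..s, (4 * r)⁻¹ • ∫ t in (0 : ℝ)..r, B t
  have continuousOn := continuousOn_inv_smul_primitive hB
  have hasDerivAt {s : ℝ} (hs : 0 < s) :
      HasDerivAt T ((4 * s)⁻¹ • ∫ t in (0 : ℝ)..s, B t) s :=
    intervalIntegral.integral_hasDerivAt_right
      (continuousOn.mono fun t ht => (lt_min one_pos hs).trans_le ht.1).intervalIntegrable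
      (continuousOn.stronglyMeasurableAtFilter isOpen_Ioi s hs)
      (continuousOn.continuousAt (Ioi_mem_nhds hs))
  have locallyIntegrable_F : LocallyIntegrableOn F (Ioi 0) := hF.locallyIntegrableOn _
  have locallyIntegrable_T : LocallyIntegrableOn T (Ioi 0) :=
    ContinuousOn.locallyIntegrableOn
      (fun s hs => (hasDerivAt hs).continuousAt.continuousWithinAt) measurableSet_Ioi
  obtain ⟨c, hc⟩ := ae_eq_const_of_integral_deriv_smul_eq_zero
    (locallyIntegrable_F.sub locallyIntegrable_T) fun P smooth compact supp => by
      have integrable {f : ℝ → E} (hf : LocallyIntegrableOn f (Ioi 0)) :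
          Integrable fun s => deriv P s • f s :=
        integrable_smul_of_tsupport_subset hf (smooth.continuous_deriv (by simp)) compact.deriv
          (tsupport_deriv_subset.trans supp)
      simp only [Pi.sub_apply, smul_sub]
      rw [integral_sub (integrable locallyIntegrable_F) (integrable locallyIntegrable_T),
        integral_deriv_smul_eq_of_isWeakRadialSolution hB hF₀ hB₀ hw smooth compact supp, sub_self]
  refine ⟨fun s => T s + c, fun s hs => (hasDerivAt hs).add_const c, ?_⟩
  filter_upwards [hc] with s hs s_pos
  rw [← hs s_pos, Pi.sub_apply, add_sub_cancel]

end

/-! ### The ordinary differential equation of a radial solution -/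

lemma hasCompactSupport_comp_norm_sq {g : ℝ → ℂ} (hg : HasCompactSupport g) :
    HasCompactSupport fun x : ℂ => g (‖x‖ ^ 2) := by
  obtain ⟨b, hb⟩ := hg.isCompact.bddAbove
  refine HasCompactSupport.intro (isCompact_closedBall (0 : ℂ) (√b)) fun x hx => ?_
  refine image_eq_zero_of_notMem_tsupport fun mem => hx ?_
  exact mem_closedBall_zero_iff.2 (Real.le_sqrt_of_sq_le (hb mem))

lemma IsSolution.aestronglyMeasurable {V : ℂ → ℝ} {z : ℂ} {u : ℂ → ℂ} (h : IsSolution V z u) :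
    AEStronglyMeasurable u := by
  rw [← Measure.restrict_univ (μ := (volume : Measure ℂ)), ← Metric.iUnion_closedBall_nat (0 : ℂ),
    aestronglyMeasurable_iUnion_iff]
  exact fun n => (h.1 _ (isCompact_closedBall 0 n)).1

lemma IsSolution.integrableOn_closedBall {V : ℂ → ℝ} {z : ℂ} {u : ℂ → ℂ}
    (h : IsSolution V z u) (R : ℝ) : IntegrableOn u (Metric.closedBall 0 R) := by
  have : IsFiniteMeasure ((volume : Measure ℂ).restrict (Metric.closedBall 0 R)) :=
    ⟨by rw [Measure.restrict_apply_univ]; exact measure_closedBall_lt_top⟩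
  exact (h.1 _ (isCompact_closedBall 0 R)).integrable one_le_two

section

variable {V : ℂ → ℝ} {w : ℝ → ℝ} {z : ℂ} {u : ℂ → ℂ} {f : ℝ → ℂ}

lemma IsSolution.locallyIntegrable_indicator (h : IsSolution V z u) (hf : StronglyMeasurable f)
    (huf : ∀ᵐ x : ℂ, u x = f (‖x‖ ^ 2)) : LocallyIntegrable (indicator (Ioi 0) f) := by
  refine locallyIntegrable_iff.2 fun K hK => ?_
  obtain ⟨M, hM⟩ := hK.bddAbove
  rcases lt_or_ge M 0 with M_neg | M_nonneg
  · refine integrableOn_zero.congr_fun (fun s hs => ?_) hK.measurableSet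
    rw [indicator_of_notMem fun mem => ((mem_Ioi.1 mem).trans_le (hM hs)).not_gt M_neg]
  have mem_iff (x : ℂ) : x ∈ Metric.closedBall 0 (√M) ↔ ‖x‖ ^ 2 ∈ Iic M := by
    rw [mem_closedBall_zero_iff, Real.le_sqrt (norm_nonneg x) M_nonneg, mem_Iic]
  have integrable_indicator :=
    (integrable_indicator_iff measurableSet_closedBall).2 (h.integrableOn_closedBall (√M))
  have integrable_comp : Integrable fun x : ℂ => (Iic M).indicator f (‖x‖ ^ 2) := by
    refine integrable_indicator.congr ?_
    filter_upwards [huf] with x hx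
    by_cases mem : ‖x‖ ^ 2 ∈ Iic M
    · rw [indicator_of_mem mem, indicator_of_mem ((mem_iff x).2 mem), hx]
    · rw [indicator_of_notMem mem, indicator_of_notMem (mt (mem_iff x).1 mem)]
  rw [integrable_comp_norm_sq_iff (hf.indicator measurableSet_Iic).aestronglyMeasurable,
    ← integrable_indicator_iff measurableSet_Ioi, indicator_indicator, inter_comm,
    ← indicator_indicator, integrable_indicator_iff measurableSet_Iic] at integrable_comp
  exact integrable_comp.mono_set hM

lemma IsSolution.setIntegral_eq_zero (h : IsSolution V z u) (hw : Measurable w)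
    (hV : ∀ x, V x = w (‖x‖ ^ 2)) (hf : StronglyMeasurable f)
    (huf : ∀ᵐ x : ℂ, u x = f (‖x‖ ^ 2)) {g : ℝ → ℂ} (hg : ContDiff ℝ ∞ g)
    (hc : HasCompactSupport g) :
    ∫ s in Ioi (0 : ℝ), f s * (-(4 * s * deriv (deriv g) s + 4 * deriv g s) +
      (w s - z) * g s) = 0 := by
  have plane_eq : ∫ x : ℂ, f (‖x‖ ^ 2) * (-(4 * (‖x‖ ^ 2 : ℝ) * deriv (deriv g) (‖x‖ ^ 2) +
      4 * deriv g (‖x‖ ^ 2)) + (w (‖x‖ ^ 2) - z) * g (‖x‖ ^ 2)) = 0 := by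
    rw [← h.2 (fun x => g (‖x‖ ^ 2)) (hg.comp (contDiff_norm_sq ℝ))
      (hasCompactSupport_comp_norm_sq hc)]
    refine integral_congr_ae ?_
    filter_upwards [huf] with x hx
    rw [laplacian_comp_norm_sq (hg.of_le (by norm_cast)), hV, hx]
  have measurable : Measurable fun s : ℝ =>
      -(4 * s * deriv (deriv g) s + 4 * deriv g s) + (w s - z) * g s := by
    have measurable_g := hg.continuous.measurable
    fun_prop
  rw [integral_comp_norm_sq (G := fun s => f s * (-(4 * s * deriv (deriv g) s + 4 * deriv g s) +
      (w s - z) * g s)) (hf.aestronglyMeasurable.mul measurable.aestronglyMeasurable)] at plane_eq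
  exact (mul_eq_zero.1 plane_eq).resolve_left (Complex.ofReal_ne_zero.2 Real.pi_ne_zero)

lemma IsSolution.isWeakRadialSolution (h : IsSolution V z u) (hw : Measurable w)
    (hV : ∀ x, V x = w (‖x‖ ^ 2)) (hf : StronglyMeasurable f)
    (huf : ∀ᵐ x : ℂ, u x = f (‖x‖ ^ 2))
    (hB : LocallyIntegrable fun s => ((w s : ℂ) - z) * indicator (Ioi 0) f s) :
    IsWeakRadialSolution (indicator (Ioi 0) f)
      fun s => ((w s : ℂ) - z) * indicator (Ioi 0) f s := by
  intro g hg hc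
  have smooth_deriv : ContDiff ℝ ∞ (deriv g) := (contDiff_infty_iff_deriv.1 hg).2
  have deriv_ofReal {k : ℝ → ℝ} (hk : ContDiff ℝ ∞ k) :
      deriv (fun s => (k s : ℂ)) = fun s => ((deriv k s : ℝ) : ℂ) :=
    funext fun s => (hk.differentiable (by simp) s).hasDerivAt.ofReal_comp.deriv
  have integral_eq_zero := h.setIntegral_eq_zero hw hV hf huf
    (g := fun s => (g s : ℂ)) (Complex.ofRealCLM.contDiff.comp hg)
    (hc.comp_left (g := fun r : ℝ => (r : ℂ)) Complex.ofReal_zero)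
  rw [deriv_ofReal hg, deriv_ofReal smooth_deriv, ← integral_indicator measurableSet_Ioi]
    at integral_eq_zero
  have integrable_B := hB.integrable_smul_left_of_hasCompactSupport hg.continuous hc
  have locallyIntegrable_F := h.locallyIntegrable_indicator hf huf
  have integrable_F := locallyIntegrable_F.integrable_smul_left_of_hasCompactSupport
    (g := fun s => 4 * (s * deriv (deriv g) s + deriv g s))
    (continuous_const.mul ((continuous_id.mul (smooth_deriv.continuous_deriv (by simp))).add
      smooth_deriv.continuous)) ((hc.deriv.deriv.mul_left.add hc.deriv).mul_left)
  rw [← sub_eq_zero, ← integral_sub integrable_B integrable_F, ← integral_eq_zero]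
  refine integral_congr_ae (Eventually.of_forall fun s => ?_)
  by_cases hs : s ∈ Ioi (0 : ℝ)
  · simp only [indicator_of_mem hs, Complex.real_smul]
    push_cast
    ring
  · simp only [indicator_of_notMem hs, mul_zero, smul_zero, sub_zero]

lemma IsSolution.exists_ode (h : IsSolution V z u) (hw : Measurable w) {C : ℝ}
    (hC : ∀ s, |w s| ≤ C) (hV : ∀ x, V x = w (‖x‖ ^ 2)) (hr : IsRadial u) :
    ∃ F Q : ℝ → ℂ, Continuous Q ∧ Q 0 = 0 ∧
      (∀ s, 0 < s → HasDerivAt F (Q s / (4 * s)) s) ∧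
      (∀ s v, 0 < s → (∀ᶠ t in 𝓝 s, w t = v) → HasDerivAt Q ((v - z) * F s) s) ∧
      ∀ᵐ x : ℂ, u x = F (‖x‖ ^ 2) := by
  obtain ⟨f, measurable_f, huf⟩ := hr.exists_stronglyMeasurable h.aestronglyMeasurable
  have locallyIntegrable_f := h.locallyIntegrable_indicator measurable_f huf
  set B : ℝ → ℂ := fun s => ((w s : ℂ) - z) * indicator (Ioi 0) f s with hB
  have locallyIntegrable_B : LocallyIntegrable B := fun t => by
    obtain ⟨U, hU, integrable⟩ := locallyIntegrable_f t
    refine ⟨U, hU, integrable.bdd_mul (c := C + ‖z‖) (by fun_prop) (Eventually.of_forall fun s =>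
      (norm_sub_le _ _).trans ?_)⟩
    rw [Complex.norm_real]
    exact add_le_add_left (hC s) _
  have f_eq_zero : ∀ s ≤ 0, indicator (Ioi 0) f s = 0 := fun s hs =>
    indicator_of_notMem (notMem_Ioi.2 hs) f
  obtain ⟨F, hasDerivAt_F, f_eq⟩ := exists_ode_of_isWeakRadialSolution locallyIntegrable_B f_eq_zero
    (fun s hs => by simp only [hB, f_eq_zero s hs, mul_zero])
    (h.isWeakRadialSolution hw hV measurable_f huf locallyIntegrable_B) locallyIntegrable_f
  refine ⟨F, fun s => ∫ t in (0 : ℝ)..s, B t,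
    continuous_primitive_of_locallyIntegrable locallyIntegrable_B 0,
    intervalIntegral.integral_same, fun s hs => ?_, fun s v hs hv => ?_, ?_⟩
  · refine (hasDerivAt_F s hs).congr_deriv ?_
    rw [Complex.real_smul, div_eq_inv_mul]
    push_cast
    rfl
  · have tendsto_F : Tendsto (fun t => ((v : ℂ) - z) * F t) (𝓝 s) (𝓝 ((v - z) * F s)) :=
      (hasDerivAt_F s hs).continuousAt.const_mul _
    refine intervalIntegral.integral_hasDerivAt_of_tendsto_ae_right
      (intervalIntegrable_of_locallyIntegrable locallyIntegrable_B 0 s)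
      locallyIntegrable_B.aestronglyMeasurable.stronglyMeasurableAtFilter
      ((tendsto_F.mono_left inf_le_left).congr' ?_)
    filter_upwards [hv.filter_mono inf_le_left, f_eq.filter_mono inf_le_right,
      (eventually_gt_nhds hs).filter_mono inf_le_left] with t w_eq f_eq t_pos
    simp only [hB, w_eq, f_eq t_pos]
  · have f_eq_F : ∀ᵐ s : ℝ, 0 < s → f s = F s := by
      filter_upwards [f_eq] with s hs s_pos
      rw [← hs s_pos, indicator_of_mem (mem_Ioi.2 s_pos)]
    filter_upwards [huf, ae_norm_sq_of_ae f_eq_F] with x hx hF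
    rw [hx, hF]

end

/-- `F` and `Q = 4 s F'` solve the radial equation in the variable `s = r²`, with constant `κ` for
`s < σ` and `z` for `s > σ`, and the solution is regular at the origin. -/
structure IsRadialProfile (σ : ℝ) (κ z : ℂ) (F Q : ℝ → ℂ) : Prop where
  hasDerivAt_fst : ∀ s, 0 < s → HasDerivAt F (Q s / (4 * s)) s
  continuous_snd : Continuous Q
  snd_zero : Q 0 = 0
  hasDerivAt_inner : ∀ s, 0 < s → s < σ → HasDerivAt Q (-κ * F s) s
  hasDerivAt_outer : ∀ s, σ < s → HasDerivAt Q (-z * F s) s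

lemma circularWell_eq_indicator {ρ : ℝ} (hρ : 0 ≤ ρ) (asq : ℝ) (x : ℂ) :
    circularWell ρ asq x = indicator (Iic (ρ ^ 2)) (fun _ => -asq) (‖x‖ ^ 2) := by
  simp only [circularWell, indicator_apply, mem_Iic, sq_le_sq₀ (norm_nonneg x) hρ]

lemma IsSolution.exists_isRadialProfile {ρ asq : ℝ} (hρ : 0 ≤ ρ) {z : ℂ} {u : ℂ → ℂ}
    (hr : IsRadial u) (h : IsSolution (circularWell ρ asq) z u) :
    ∃ F Q : ℝ → ℂ, IsRadialProfile (ρ ^ 2) (asq + z) z F Q ∧ ∀ᵐ x : ℂ, u x = F (‖x‖ ^ 2) := by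
  obtain ⟨F, Q, continuous_Q, Q_zero, hasDerivAt_F, hasDerivAt_Q, u_eq⟩ :=
    h.exists_ode (w := indicator (Iic (ρ ^ 2)) fun _ => -asq) (C := |asq|)
      (measurable_const.indicator measurableSet_Iic)
      (fun s => (norm_indicator_le_norm_self (fun _ => -asq) s).trans (abs_neg asq).le)
      (circularWell_eq_indicator hρ asq) hr
  refine ⟨F, Q, ⟨hasDerivAt_F, continuous_Q, Q_zero, fun s s_pos hs => ?_, fun s hs => ?_⟩, u_eq⟩
  · convert hasDerivAt_Q s (-asq) s_pos ?_ using 1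
    · push_cast
      ring
    · filter_upwards [Iio_mem_nhds hs] with t ht
      exact indicator_of_mem (mem_Iic.2 (mem_Iio.1 ht).le) _
  · convert hasDerivAt_Q s 0 ((sq_nonneg ρ).trans_lt hs) ?_ using 1
    · push_cast
      ring
    · filter_upwards [Ioi_mem_nhds hs] with t ht
      exact indicator_of_notMem (notMem_Iic.2 ht) _

/-! ### Wronskians -/

/-- The pair `F`, `Q = 4 s F'` solves `Q' = -c F` at `s`; this is the radial equation
`(-Δ - c) u = 0` for `u(x) = F(‖x‖²)`. -/
def IsPairAt (c : ℂ) (F Q : ℝ → ℂ) (s : ℝ) : Prop :=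
  HasDerivAt F (Q s / (4 * s)) s ∧ HasDerivAt Q (-c * F s) s

/-- The Wronskian `F R - Q G` of the pairs `(F, Q)` and `(G, R)`, constant when both solve the same
equation. -/
def wronskian (F Q G R : ℝ → ℂ) (s : ℝ) : ℂ := F s * R s - Q s * G s

lemma IsPairAt.hasDerivAt_wronskian {c : ℂ} {F Q G R : ℝ → ℂ} {s : ℝ} (hF : IsPairAt c F Q s)
    (hG : IsPairAt c G R s) : HasDerivAt (wronskian F Q G R) 0 s := by
  refine ((hF.1.mul hG.2).sub (hF.2.mul hG.1)).congr_deriv ?_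
  ring

lemma wronskian_eq_of_mem_closure {c : ℂ} {F Q G R : ℝ → ℂ} {U : Set ℝ} (hU : IsOpen U)
    (hU' : IsPreconnected U) (hF : ∀ s ∈ U, IsPairAt c F Q s) (hG : ∀ s ∈ U, IsPairAt c G R s)
    {s t : ℝ} (hs : s ∈ U) (ht : t ∈ closure U)
    (hc : ContinuousWithinAt (wronskian F Q G R) U t) :
    wronskian F Q G R s = wronskian F Q G R t := by
  have hasDerivAt {s : ℝ} (hs : s ∈ U) : HasDerivAt (wronskian F Q G R) 0 s :=
    (hF s hs).hasDerivAt_wronskian (hG s hs)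
  obtain ⟨w, hw⟩ := hU.exists_is_const_of_deriv_eq_zero hU'
    (fun s hs => (hasDerivAt hs).differentiableAt.differentiableWithinAt)
    fun s hs => (hasDerivAt hs).deriv
  have : (𝓝[U] t).NeBot := mem_closure_iff_nhdsWithin_neBot.1 ht
  refine tendsto_nhds_unique (tendsto_const_nhds.congr' ?_) hc
  filter_upwards [self_mem_nhdsWithin] with r hr
  rw [hw s hs, hw r hr]

/-- The solution `J₀(√(c s))` of the radial equation with constant `c`. -/
def regF (c : ℂ) (s : ℝ) : ℂ := cliffordJ (c * s / 4)

/-- `4 s` times the derivative of the regular solution `regF`. -/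
def regQ (c : ℂ) (s : ℝ) : ℂ := c * s * deriv cliffordJ (c * s / 4)

/-- A logarithmic solution of the radial equation with constant `c`; changing `C` adds multiples of
the regular solution, and Neumann's and Hankel's functions correspond to particular values. -/
def logF (c C : ℂ) (s : ℝ) : ℂ :=
  ((Real.log s : ℂ) / 2 + C) * cliffordJ (c * s / 4) - cliffordN (c * s / 4)

/-- `4 s` times the derivative of the logarithmic solution `logF`. -/
def logQ (c C : ℂ) (s : ℝ) : ℂ :=
  2 * cliffordJ (c * s / 4) +
    c * s * (((Real.log s : ℂ) / 2 + C) * deriv cliffordJ (c * s / 4) -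
      deriv cliffordN (c * s / 4))

lemma hasDerivAt_mul_ofReal (c : ℂ) (s : ℝ) : HasDerivAt (fun s : ℝ => c * (s : ℂ)) c s := by
  simpa using (hasDerivAt_id s).ofReal_comp.const_mul c

lemma hasDerivAt_comp_mul_ofReal_div {f : ℂ → ℂ} {f' : ℂ} (c : ℂ) (s : ℝ)
    (hf : HasDerivAt f f' (c * s / 4)) :
    HasDerivAt (fun s : ℝ => f (c * s / 4)) (f' * (c / 4)) s :=
  hf.comp s ((hasDerivAt_mul_ofReal c s).div_const 4)

lemma isPairAt_reg (c : ℂ) {s : ℝ} (hs : s ≠ 0) : IsPairAt c (regF c) (regQ c) s := by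
  constructor
  · refine (hasDerivAt_comp_mul_ofReal_div c s (hasDerivAt_cliffordJ _)).congr_deriv ?_
    rw [regQ]
    field_simp [Complex.ofReal_ne_zero.2 hs]
  · refine ((hasDerivAt_mul_ofReal c s).mul
      (hasDerivAt_comp_mul_ofReal_div c s (hasDerivAt_deriv_cliffordJ _))).congr_deriv ?_
    rw [regF]
    linear_combination c * cliffordJ_ode (c * s / 4)

lemma isPairAt_log (c C : ℂ) {s : ℝ} (hs : s ≠ 0) : IsPairAt c (logF c C) (logQ c C) s := by
  have s_ne : (s : ℂ) ≠ 0 := Complex.ofReal_ne_zero.2 hs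
  have hasDerivAt_log : HasDerivAt (fun s : ℝ => (Real.log s : ℂ) / 2 + C) ((s : ℂ)⁻¹ / 2) s := by
    simpa using ((Real.hasDerivAt_log hs).ofReal_comp.div_const 2).add_const C
  have hasDerivAt_J := hasDerivAt_comp_mul_ofReal_div c s (hasDerivAt_cliffordJ _)
  constructor
  · refine ((hasDerivAt_log.mul hasDerivAt_J).sub
      (hasDerivAt_comp_mul_ofReal_div c s (hasDerivAt_cliffordN _))).congr_deriv ?_
    rw [logQ]
    field_simp
    ring
  · refine ((hasDerivAt_J.const_mul 2).add ((hasDerivAt_mul_ofReal c s).mul ((hasDerivAt_log.mul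
      (hasDerivAt_comp_mul_ofReal_div c s (hasDerivAt_deriv_cliffordJ _))).sub
      (hasDerivAt_comp_mul_ofReal_div c s (hasDerivAt_deriv_cliffordN _))))).congr_deriv ?_
    rw [logF]
    simp only [Pi.sub_apply, Pi.mul_apply]
    linear_combination (c * ((Real.log s : ℂ) / 2 + C)) * cliffordJ_ode (c * s / 4) -
      c * cliffordN_ode (c * s / 4) + c * deriv cliffordJ (c * s / 4) / 2 * mul_inv_cancel₀ s_ne

lemma wronskian_reg_log (c C : ℂ) {s : ℝ} (hs : 0 < s) :
    wronskian (regF c) (regQ c) (logF c C) (logQ c C) s = 2 := by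
  -- the logarithms cancel, so the Wronskian is continuous at the origin
  have wronskian_eq : wronskian (regF c) (regQ c) (logF c C) (logQ c C) = fun s : ℝ =>
      2 * cliffordJ (c * s / 4) ^ 2 +
        c * s * (deriv cliffordJ (c * s / 4) * cliffordN (c * s / 4) -
          cliffordJ (c * s / 4) * deriv cliffordN (c * s / 4)) := by
    funext s
    rw [wronskian, regF, regQ, logF, logQ]
    ring
  have continuous : Continuous (wronskian (regF c) (regQ c) (logF c C) (logQ c C)) := by
    have := continuous_deriv_cliffordJ
    have := continuous_deriv_cliffordN
    rw [wronskian_eq]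
    fun_prop
  rw [wronskian_eq_of_mem_closure isOpen_Ioi isPreconnected_Ioi
    (fun t ht => isPairAt_reg c (mem_Ioi.1 ht).ne')
    (fun t ht => isPairAt_log c C (mem_Ioi.1 ht).ne') (mem_Ioi.2 hs) (t := 0)
    (by rw [closure_Ioi]; exact self_mem_Ici)
    continuous.continuousWithinAt, wronskian_eq]
  simp [cliffordJ_zero]

lemma cliffordJ_ne_zero_of_deriv_eq_zero {w : ℂ} (h : deriv cliffordJ w = 0) :
    cliffordJ w ≠ 0 := by
  intro h_zero
  have wronskian_eq := wronskian_reg_log w 0 (s := 4) (by norm_num)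
  have w_eq : w * ((4 : ℝ) : ℂ) / 4 = w := by
    push_cast
    ring
  rw [wronskian, regF, regQ, w_eq, h, h_zero] at wronskian_eq
  norm_num at wronskian_eq

/-! ### Radial solutions of the circular well -/

namespace IsRadialProfile

variable {σ : ℝ} {κ z : ℂ} {F Q : ℝ → ℂ}

lemma exists_norm_fst_le (h : IsRadialProfile σ κ z F Q) :
    ∃ M : ℝ, ∀ s, 0 < s → s ≤ 1 → ‖F s‖ ≤ ‖F 1‖ - M * Real.log s := by
  obtain ⟨M, hM⟩ := (isCompact_Icc (a := (0 : ℝ)) (b := 1)).exists_bound_of_continuousOn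
    h.continuous_snd.continuousOn
  refine ⟨M / 4, fun s hs s_le => ?_⟩
  have pos_of_mem {t : ℝ} (ht : t ∈ uIcc s 1) : 0 < t := by
    rw [uIcc_of_le s_le] at ht
    exact hs.trans_le ht.1
  have intervalIntegrable : IntervalIntegrable (fun t : ℝ => Q t / (4 * t)) volume s 1 := by
    have := h.continuous_snd
    refine (ContinuousOn.div (by fun_prop) (by fun_prop) fun t ht => ?_).intervalIntegrable
    exact mul_ne_zero (by norm_num) (Complex.ofReal_ne_zero.2 (pos_of_mem ht).ne')
  have fundamental := intervalIntegral.integral_eq_sub_of_hasDerivAt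
    (fun t ht => h.hasDerivAt_fst t (pos_of_mem ht)) intervalIntegrable
  have norm_integral_le : ‖∫ t in s..1, Q t / (4 * t)‖ ≤ ∫ t in s..1, M / 4 * t⁻¹ := by
    refine intervalIntegral.norm_integral_le_of_norm_le s_le (Eventually.of_forall fun t ht => ?_)
      ((intervalIntegral.intervalIntegrable_inv (fun t ht => (pos_of_mem ht).ne')
        continuousOn_id).const_mul _)
    have t_pos : 0 < t := hs.trans ht.1
    rw [norm_div, norm_mul, Complex.norm_real, Real.norm_of_nonneg t_pos.le, Complex.norm_ofNat,
      div_mul_eq_div_div, ← div_eq_mul_inv]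
    gcongr
    exact hM t ⟨t_pos.le, ht.2⟩
  rw [fundamental, intervalIntegral.integral_const_mul, integral_inv_of_pos hs one_pos, one_div,
    Real.log_inv] at norm_integral_le
  linarith [norm_le_norm_add_norm_sub (F 1) (F s)]

lemma tendsto_mul_fst (h : IsRadialProfile σ κ z F Q) :
    Tendsto (fun s : ℝ => (s : ℂ) * F s) (𝓝[>] 0) (𝓝 0) := by
  obtain ⟨M, hM⟩ := h.exists_norm_fst_le
  have tendsto_bound : Tendsto (fun s : ℝ => s * ‖F 1‖ - M * (s * Real.log s)) (𝓝[>] 0) (𝓝 0) := by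
    have continuous : Continuous fun s : ℝ => s * ‖F 1‖ - M * (s * Real.log s) :=
      (continuous_id.mul_const _).sub (Real.continuous_mul_log.const_mul M)
    simpa using (continuous.tendsto 0).mono_left nhdsWithin_le_nhds
  refine squeeze_zero_norm' ?_ tendsto_bound
  filter_upwards [Ioc_mem_nhdsGT one_pos] with s hs
  rw [norm_mul, Complex.norm_real, Real.norm_of_nonneg hs.1.le]
  linarith [mul_le_mul_of_nonneg_left (hM s hs.1 hs.2) hs.1.le]

lemma continuousWithinAt_wronskian (h : IsRadialProfile σ κ z F Q) {c : ℂ} {G R : ℝ → ℂ} {s : ℝ}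
    (hs : 0 < s) (hG : IsPairAt c G R s) (U : Set ℝ) :
    ContinuousWithinAt (wronskian F Q G R) U s :=
  (((h.hasDerivAt_fst s hs).continuousAt.mul hG.2.continuousAt).sub
    (h.continuous_snd.continuousAt.mul hG.1.continuousAt)).continuousWithinAt

lemma wronskian_inner_eq (h : IsRadialProfile σ κ z F Q) {G R : ℝ → ℂ}
    (hG : ∀ s, 0 < s → IsPairAt κ G R s) {s : ℝ} (hs : 0 < s) (hsσ : s < σ) :
    wronskian F Q G R s = wronskian F Q G R σ :=
  have σ_pos : 0 < σ := hs.trans hsσ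
  wronskian_eq_of_mem_closure isOpen_Ioo isPreconnected_Ioo
    (fun t ht => ⟨h.hasDerivAt_fst t ht.1, h.hasDerivAt_inner t ht.1 ht.2⟩)
    (fun t ht => hG t ht.1) ⟨hs, hsσ⟩ (by rw [closure_Ioo σ_pos.ne]; exact right_mem_Icc.2 σ_pos.le)
    (h.continuousWithinAt_wronskian σ_pos (hG σ σ_pos) _)

lemma wronskian_outer_eq (h : IsRadialProfile σ κ z F Q) (hσ : 0 < σ) {G R : ℝ → ℂ}
    (hG : ∀ s, 0 < s → IsPairAt z G R s) {s : ℝ} (hs : σ < s) :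
    wronskian F Q G R s = wronskian F Q G R σ :=
  wronskian_eq_of_mem_closure isOpen_Ioi isPreconnected_Ioi
    (fun t ht => ⟨h.hasDerivAt_fst t (hσ.trans ht), h.hasDerivAt_outer t ht⟩)
    (fun t ht => hG t (hσ.trans ht)) hs (by rw [closure_Ioi]; exact self_mem_Ici)
    (h.continuousWithinAt_wronskian hσ (hG σ hσ) _)

-- Inside the well `F` is a multiple of the regular solution.
lemma wronskian_reg_eq_zero (h : IsRadialProfile σ κ z F Q) (hσ : 0 < σ) :
    wronskian F Q (regF κ) (regQ κ) σ = 0 := by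
  have tendsto_zero : Tendsto (wronskian F Q (regF κ) (regQ κ)) (𝓝[>] 0) (𝓝 0) := by
    have continuous_reg : Continuous fun s : ℝ => κ * deriv cliffordJ (κ * s / 4) := by
      have := continuous_deriv_cliffordJ
      fun_prop
    have continuous_snd_mul : Continuous fun s : ℝ => Q s * cliffordJ (κ * s / 4) := by
      have := h.continuous_snd
      fun_prop
    have tendsto_sub :=
      (h.tendsto_mul_fst.mul ((continuous_reg.tendsto 0).mono_left nhdsWithin_le_nhds)).sub
        ((continuous_snd_mul.tendsto 0).mono_left (nhdsWithin_le_nhds (s := Ioi 0)))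
    simp only [h.snd_zero, zero_mul, sub_zero] at tendsto_sub
    refine tendsto_sub.congr fun s => ?_
    rw [wronskian, regF, regQ]
    ring
  refine tendsto_nhds_unique (tendsto_const_nhds.congr' ?_) tendsto_zero
  filter_upwards [Ioo_mem_nhdsGT hσ] with s hs
  exact (h.wronskian_inner_eq (fun t ht => isPairAt_reg κ ht.ne') hs.1 hs.2).symm

lemma fst_eq_zero (h : IsRadialProfile σ κ z F Q) (hσ : 0 < σ) (hF : F σ = 0) (hQ : Q σ = 0)
    {s : ℝ} (hs : 0 < s) : F s = 0 := by
  have eq_zero_of_wronskian (c : ℂ) (hreg : wronskian F Q (regF c) (regQ c) s = 0)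
      (hlog : wronskian F Q (logF c 0) (logQ c 0) s = 0) : F s = 0 := by
    have wronskian_eq := wronskian_reg_log c 0 hs
    rw [wronskian] at hreg hlog wronskian_eq
    linear_combination
      (-F s / 2) * wronskian_eq + (regF c s / 2) * hlog - (logF c 0 s / 2) * hreg
  have wronskian_edge (G R : ℝ → ℂ) : wronskian F Q G R σ = 0 := by
    rw [wronskian, hF, hQ, zero_mul, zero_mul, sub_zero]
  rcases lt_trichotomy s σ with hlt | rfl | hgt
  · refine eq_zero_of_wronskian κ ?_ ?_
    · rw [h.wronskian_inner_eq (fun t ht => isPairAt_reg κ ht.ne') hs hlt, wronskian_edge]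
    · rw [h.wronskian_inner_eq (fun t ht => isPairAt_log κ 0 ht.ne') hs hlt, wronskian_edge]
  · exact hF
  · refine eq_zero_of_wronskian z ?_ ?_
    · rw [h.wronskian_outer_eq hσ (fun t ht => isPairAt_reg z ht.ne') hgt, wronskian_edge]
    · rw [h.wronskian_outer_eq hσ (fun t ht => isPairAt_log z 0 ht.ne') hgt, wronskian_edge]

lemma fst_ne_zero_or_snd_ne_zero (h : IsRadialProfile σ κ z F Q) (hσ : 0 < σ) {u : ℂ → ℂ}
    (hu : ∀ᵐ x : ℂ, u x = F (‖x‖ ^ 2)) (hn : IsNontrivial u) : F σ ≠ 0 ∨ Q σ ≠ 0 := by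
  by_contra! data_eq_zero
  refine hn ?_
  filter_upwards [hu, Measure.ae_ne volume 0] with x hx x_ne
  rw [hx, h.fst_eq_zero hσ data_eq_zero.1 data_eq_zero.2 (pow_pos (norm_pos_iff.2 x_ne) 2)]

lemma matching (h : IsRadialProfile σ κ z F Q) (hσ : 0 < σ) {u : ℂ → ℂ}
    (hu : ∀ᵐ x : ℂ, u x = F (‖x‖ ^ 2)) (hn : IsNontrivial u) {G R : ℝ → ℂ}
    (hw : wronskian F Q G R σ = 0) : regQ κ σ * G σ = R σ * regF κ σ := by
  have wronskian_reg := h.wronskian_reg_eq_zero hσ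
  rw [wronskian] at wronskian_reg hw
  rcases h.fst_ne_zero_or_snd_ne_zero hσ hu hn with F_ne | Q_ne
  · refine mul_left_cancel₀ F_ne ?_
    linear_combination G σ * wronskian_reg - regF κ σ * hw
  · refine mul_left_cancel₀ Q_ne ?_
    linear_combination R σ * wronskian_reg - regQ κ σ * hw

end IsRadialProfile

/-! ### Matching for eigenfunctions -/

lemma isPairAt_macdonald {E : ℝ} (hE : E < 0) {s : ℝ} (hs : 0 < s) :
    IsPairAt (E : ℂ) (fun s => (macdonald 0 (-E * s / 4) : ℂ))
      (fun s => ((-4 * macdonald 1 (-E * s / 4) : ℝ) : ℂ)) s := by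
  have arg_pos : 0 < -E * s / 4 := by
    have := mul_pos (neg_pos.2 hE) hs
    positivity
  have hasDerivAt_arg : HasDerivAt (fun s : ℝ => -E * s / 4) (-E / 4) s := by
    simpa using ((hasDerivAt_id s).const_mul (-E)).div_const 4
  have s_ne : (s : ℂ) ≠ 0 := Complex.ofReal_ne_zero.2 hs.ne'
  have E_ne : (E : ℂ) ≠ 0 := Complex.ofReal_ne_zero.2 hE.ne
  constructor
  · refine ((hasDerivAt_macdonald 0 arg_pos).comp s hasDerivAt_arg).ofReal_comp.congr_deriv ?_
    rw [zero_sub, macdonald_neg_one arg_pos]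
    push_cast
    field_simp
  · refine (((hasDerivAt_macdonald 1 arg_pos).comp s hasDerivAt_arg).const_mul
      (-4)).ofReal_comp.congr_deriv ?_
    rw [sub_self]
    push_cast
    ring

lemma tendsto_macdonald_zero_atTop : Tendsto (macdonald 0) atTop (𝓝 0) :=
  squeeze_zero' (Eventually.of_forall fun y => macdonald_nonneg 0 y)
    ((eventually_gt_atTop 0).mono fun _ hy => (macdonald_zero_le hy).trans_eq (one_div _))
    tendsto_inv_atTop_zero

lemma one_le_norm_regF {E : ℝ} (hE : E ≤ 0) {s : ℝ} (hs : 0 ≤ s) : 1 ≤ ‖regF (E : ℂ) s‖ := by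
  have regF_eq : regF (E : ℂ) s = cliffordJ (-((-E * s / 4 : ℝ) : ℂ)) := by
    rw [regF]
    push_cast
    ring_nf
  have arg_nonneg := mul_nonneg (neg_nonneg.2 hE) hs
  rw [regF_eq]
  exact one_le_norm_cliffordJ_neg (by positivity)

lemma volume_lt_norm_sq (S : ℝ) : volume {x : ℂ | S < ‖x‖ ^ 2} = ⊤ := by
  have eq_compl : {x : ℂ | S < ‖x‖ ^ 2} = ((fun x : ℂ => ‖x‖ ^ 2) ⁻¹' Iic S)ᶜ := by
    ext x
    simp
  have preimage_ne_top : volume ((fun x : ℂ => ‖x‖ ^ 2) ⁻¹' Iic S) ≠ ⊤ := by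
    rw [volume_norm_sq_preimage_Iic]
    exact ENNReal.mul_ne_top ENNReal.ofReal_ne_top ENNReal.ofReal_ne_top
  rw [eq_compl, measure_compl (measurable_norm_sq measurableSet_Iic) preimage_ne_top,
    measure_univ_of_isAddLeftInvariant, ENNReal.top_sub preimage_ne_top]

lemma not_memLp_of_le_norm {F : ℝ → ℂ} {u : ℂ → ℂ} (hu : ∀ᵐ x : ℂ, u x = F (‖x‖ ^ 2)) {S c : ℝ}
    (hc : 0 < c) (hF : ∀ s, S < s → c ≤ ‖F s‖) : ¬ MemLp u 2 volume := by
  intro memLp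
  have lt_top := memLp.meas_ge_lt_top two_ne_zero ENNReal.ofNat_ne_top (ε := c.toNNReal)
    (Real.toNNReal_pos.2 hc).ne'
  refine lt_top.not_ge ((volume_lt_norm_sq S).symm.le.trans (measure_mono_ae ?_))
  filter_upwards [hu] with x hx hS
  exact Real.toNNReal_le_iff_le_coe.2 (hx ▸ hF _ hS)

-- A nonzero Wronskian with the decaying solution `G` means a component along the solution `I`,
-- which does not decay.
lemma IsRadialProfile.exists_le_norm_fst {σ : ℝ} {κ z : ℂ} {F Q G R I P : ℝ → ℂ}
    (h : IsRadialProfile σ κ z F Q) (hσ : 0 < σ) (hG : ∀ s, 0 < s → IsPairAt z G R s)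
    (hI : ∀ s, 0 < s → IsPairAt z I P s) (tendsto_G : Tendsto G atTop (𝓝 0))
    (one_le : ∀ s, 0 < s → 1 ≤ ‖I s‖) (hw : wronskian F Q G R σ ≠ 0) :
    ∃ c S : ℝ, 0 < c ∧ ∀ s, S < s → c ≤ ‖F s‖ := by
  have wronskian_GI {s : ℝ} (hs : σ < s) : wronskian G R I P s = wronskian G R I P σ :=
    wronskian_eq_of_mem_closure isOpen_Ioi isPreconnected_Ioi (fun t ht => hG t ht)
      (fun t ht => hI t ht) (hσ.trans hs) (subset_closure hσ)
      ((hG σ hσ).hasDerivAt_wronskian (hI σ hσ)).continuousAt.continuousWithinAt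
  have plucker {s : ℝ} (hs : σ < s) : I s * wronskian F Q G R σ =
      G s * wronskian F Q I P σ - F s * wronskian G R I P σ := by
    rw [← h.wronskian_outer_eq hσ hG hs, ← h.wronskian_outer_eq hσ hI hs, ← wronskian_GI hs]
    simp only [wronskian]
    ring
  have norm_pos : 0 < ‖wronskian F Q G R σ‖ := norm_pos_iff.2 hw
  have tendsto_mul : Tendsto (fun s => ‖G s * wronskian F Q I P σ‖) atTop (𝓝 0) := by
    simpa using (tendsto_G.mul_const (wronskian F Q I P σ)).norm
  obtain ⟨S, hS⟩ := ((tendsto_mul.eventually_lt_const (half_pos norm_pos)).and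
    (eventually_gt_atTop σ)).exists_forall_of_atTop
  refine ⟨‖wronskian F Q G R σ‖ / 2 / (‖wronskian G R I P σ‖ + 1), S, by positivity,
    fun s hs => ?_⟩
  obtain ⟨G_small, σ_lt⟩ := hS s hs.le
  have norm_le : ‖wronskian F Q G R σ‖ ≤
      ‖G s * wronskian F Q I P σ‖ + ‖F s‖ * ‖wronskian G R I P σ‖ := by
    calc ‖wronskian F Q G R σ‖ ≤ ‖I s‖ * ‖wronskian F Q G R σ‖ :=
          le_mul_of_one_le_left norm_pos.le (one_le s (hσ.trans σ_lt))
      _ = ‖G s * wronskian F Q I P σ - F s * wronskian G R I P σ‖ := by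
          rw [← norm_mul, plucker σ_lt]
      _ ≤ ‖G s * wronskian F Q I P σ‖ + ‖F s‖ * ‖wronskian G R I P σ‖ := by
          rw [← norm_mul (F s)]
          exact norm_sub_le _ _
  rw [div_le_iff₀ (by positivity)]
  linarith [norm_nonneg (F s)]

lemma IsEigenfunction.matching {ρ asq E : ℝ} (hρ : 0 < ρ) (hE : E < 0) {ψ : ℂ → ℂ}
    (hr : IsRadial ψ) (h : IsEigenfunction (circularWell ρ asq) E ψ) :
    regQ (asq + E) (ρ ^ 2) * macdonald 0 (-E * ρ ^ 2 / 4) =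
      -4 * macdonald 1 (-E * ρ ^ 2 / 4) * regF (asq + E) (ρ ^ 2) := by
  obtain ⟨memLp, nontrivial, solution⟩ := h
  obtain ⟨F, Q, profile, ψ_eq⟩ := solution.exists_isRadialProfile hρ.le hr
  have σ_pos : 0 < ρ ^ 2 := pow_pos hρ 2
  have tendsto_arg : Tendsto (fun s : ℝ => -E * s / 4) atTop atTop :=
    (tendsto_id.const_mul_atTop (neg_pos.2 hE)).atTop_div_const four_pos
  have tendsto_decaying :
      Tendsto (fun s : ℝ => (macdonald 0 (-E * s / 4) : ℂ)) atTop (𝓝 0) := by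
    rw [← Complex.ofReal_zero]
    exact (Complex.continuous_ofReal.tendsto 0).comp
      (tendsto_macdonald_zero_atTop.comp tendsto_arg)
  have matching := profile.matching σ_pos ψ_eq nontrivial (by
    by_contra wronskian_ne
    obtain ⟨c, S, c_pos, c_le⟩ := profile.exists_le_norm_fst σ_pos
      (fun s hs => isPairAt_macdonald hE hs) (fun s hs => isPairAt_reg (E : ℂ) hs.ne')
      tendsto_decaying (fun s hs => one_le_norm_regF hE.le hs.le) wronskian_ne
    exact not_memLp_of_le_norm ψ_eq c_pos c_le memLp)
  rw [matching]
  push_cast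
  ring

/-! ### Matching for resonant states -/

lemma integral_exp_mul_I_zpow {l : ℤ} (hl : l ≠ 0) :
    ∫ θ in Ioo (-Real.pi) Real.pi, Complex.exp (θ * Complex.I) ^ l = 0 := by
  have integral_eq := integral_exp_mul_complex (a := -Real.pi) (b := Real.pi)
    (mul_ne_zero (Int.cast_ne_zero.2 hl) Complex.I_ne_zero)
  have periodic : Complex.exp ((l : ℂ) * Complex.I * (Real.pi : ℝ)) =
      Complex.exp ((l : ℂ) * Complex.I * ((-Real.pi : ℝ) : ℂ)) :=
    Complex.exp_eq_exp_iff_exists_int.2 ⟨l, by push_cast; ring⟩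
  rw [periodic, sub_self, zero_div,
    intervalIntegral.integral_of_le (neg_le_self Real.pi_pos.le),
    integral_Ioc_eq_integral_Ioo] at integral_eq
  rw [← integral_eq]
  refine setIntegral_congr_fun measurableSet_Ioo fun θ _ => ?_
  rw [← Complex.exp_int_mul, mul_right_comm, mul_assoc]

lemma eq_coeff_zero_of_hasSum {a : ℤ → ℂ} {v : ℂ}
    (h : ∀ᵐ (θ : ℝ) ∂(volume.restrict (Ioo (-Real.pi) Real.pi)),
      HasSum (fun l : ℤ => a l * Complex.exp (θ * Complex.I) ^ l) v) : v = a 0 := by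
  have norm_term (l : ℤ) (θ : ℝ) : ‖a l * Complex.exp (θ * Complex.I) ^ l‖ = ‖a l‖ := by
    rw [norm_mul, norm_zpow, Complex.norm_exp_ofReal_mul_I, one_zpow, mul_one]
  have volume_ne_zero : volume.real (Ioo (-Real.pi) Real.pi) ≠ 0 := by
    rw [Real.volume_real_Ioo_of_le (neg_le_self Real.pi_pos.le)]
    linarith [Real.pi_pos]
  have restrict_ne_zero : volume.restrict (Ioo (-Real.pi) Real.pi) ≠ 0 := by
    simp [Measure.restrict_eq_zero, Real.pi_pos]
  have := ae_neBot.2 restrict_ne_zero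
  obtain ⟨θ, hθ⟩ := h.exists
  have summable : Summable fun l => ‖a l‖ := hθ.summable.norm.congr fun l => norm_term l θ
  have hasSum_integral := hasSum_integral_of_dominated_convergence
    (μ := volume.restrict (Ioo (-Real.pi) Real.pi))
    (F := fun (l : ℤ) (θ : ℝ) => a l * Complex.exp (θ * Complex.I) ^ l) (f := fun _ => v)
    (fun l _ => ‖a l‖)
    (fun l => (continuous_const.mul (Continuous.zpow₀ (by fun_prop) l fun θ =>
      Or.inl (Complex.exp_ne_zero _))).aestronglyMeasurable)
    (fun l => Eventually.of_forall fun θ => (norm_term l θ).le)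
    (Eventually.of_forall fun _ => summable) (integrable_const _) h
  have integral_term (l : ℤ) (hl : l ≠ 0) :
      ∫ θ in Ioo (-Real.pi) Real.pi, a l * Complex.exp (θ * Complex.I) ^ l = 0 := by
    rw [integral_const_mul, integral_exp_mul_I_zpow hl, mul_zero]
  have smul_eq := hasSum_integral.unique (hasSum_single 0 integral_term)
  simp only [zpow_zero, mul_one, setIntegral_const] at smul_eq
  exact smul_right_injective ℂ volume_ne_zero smul_eq

lemma IsOutgoing.exists_ae_eq_const_mul {lam : ℂ} {u : ℂ → ℂ} (h : IsOutgoing lam u) {F : ℝ → ℂ}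
    (he : ∀ᵐ x : ℂ, u x = F (‖x‖ ^ 2)) :
    ∃ (c : ℂ) (R : ℝ), 0 ≤ R ∧ ∀ᵐ r : ℝ, R < r →
      F (r ^ 2) = c * (if lam = 0 then 1 else hankel1 0 (lam * r)) := by
  obtain ⟨c, R, hc⟩ := h
  refine ⟨c 0, max R 0, le_max_right _ _, ?_⟩
  filter_upwards [(ae_restrict_iff' measurableSet_Ioi).1 (ae_ae_polarCoord_of_ae (hc.and he))]
    with r hr R_lt
  have r_pos : 0 < r := (le_max_right _ _).trans_lt R_lt
  suffices F (r ^ 2) =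
      c 0 * (if lam = 0 then (r : ℂ) ^ (-|(0 : ℤ)|) else hankel1 0 (lam * r)) by simpa using this
  refine eq_coeff_zero_of_hasSum (a := fun l => c l *
    (if lam = 0 then (r : ℂ) ^ (-|l|) else hankel1 l (lam * r))) ?_
  filter_upwards [hr r_pos] with θ hθ
  have norm_eq : ‖(r : ℂ) * Complex.exp (θ * Complex.I)‖ = r := by
    rw [norm_mul, Complex.norm_exp_ofReal_mul_I, Complex.norm_real, Real.norm_of_nonneg r_pos.le,
      mul_one]
  rw [norm_eq, mul_div_cancel_left₀ _ (Complex.ofReal_ne_zero.2 r_pos.ne')] at hθ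
  exact hθ.2 ▸ hθ.1 ((le_max_left _ _).trans_lt R_lt)

lemma eq_of_ae_comp_sq_eq {F G : ℝ → ℂ} (hF : ContinuousOn F (Ioi 0))
    (hG : ContinuousOn G (Ioi 0)) {S : ℝ} (hS : 0 ≤ S)
    (he : ∀ᵐ r : ℝ, S < r → F (r ^ 2) = G (r ^ 2)) {s : ℝ} (hs : S ^ 2 < s) : F s = G s := by
  have continuousOn_comp {H : ℝ → ℂ} (hH : ContinuousOn H (Ioi 0)) :
      ContinuousOn (fun r : ℝ => H (r ^ 2)) (Ioi S) :=
    hH.comp (continuous_pow 2).continuousOn fun r hr => pow_pos (hS.trans_lt hr) 2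
  have eqOn := Measure.eqOn_open_of_ae_eq (μ := volume)
    ((ae_restrict_iff' measurableSet_Ioi).2 he) isOpen_Ioi (continuousOn_comp hF)
    (continuousOn_comp hG)
  simpa only [Real.sq_sqrt ((sq_nonneg S).trans hs.le)] using eqOn (Real.lt_sqrt_of_sq_lt hs)

lemma IsRadialProfile.wronskian_eq_zero_of_ae {σ : ℝ} {κ z : ℂ} {F Q G R : ℝ → ℂ}
    (h : IsRadialProfile σ κ z F Q) (hσ : 0 < σ) (hG : ∀ s, 0 < s → IsPairAt z G R s)
    {c : ℂ} {S : ℝ} (hS : 0 ≤ S) (he : ∀ᵐ r : ℝ, S < r → F (r ^ 2) = c * G (r ^ 2)) :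
    wronskian F Q G R σ = 0 := by
  have F_eq {s : ℝ} (hs : S ^ 2 < s) : F s = c * G s :=
    eq_of_ae_comp_sq_eq (G := fun s => c * G s)
      (fun t ht => (h.hasDerivAt_fst t ht).continuousAt.continuousWithinAt)
      (fun t ht => ((hG t ht).1.continuousAt.const_mul c).continuousWithinAt) hS he hs
  obtain ⟨s, hs⟩ := exists_gt (max (S ^ 2) σ)
  obtain ⟨S_lt, σ_lt⟩ := max_lt_iff.1 hs
  have s_pos : 0 < s := hσ.trans σ_lt
  have four_mul_ne : 4 * (s : ℂ) ≠ 0 :=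
    mul_ne_zero (by norm_num) (Complex.ofReal_ne_zero.2 s_pos.ne')
  have deriv_eq := (h.hasDerivAt_fst s s_pos).unique (((hG s s_pos).1.const_mul c)
    |>.congr_of_eventuallyEq ((eventually_gt_nhds S_lt).mono fun t ht => F_eq ht))
  have Q_eq : Q s = c * R s := by rwa [← mul_div_assoc, div_left_inj' four_mul_ne] at deriv_eq
  rw [← h.wronskian_outer_eq hσ hG σ_lt, wronskian, F_eq S_lt, Q_eq]
  ring

/-- The constant for which the logarithmic solution `logF (λ ^ 2) _` is a multiple of
`H₀⁽¹⁾(λ r)`. -/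
def outgoingConst (lam : ℂ) : ℂ :=
  cutLog (lam / 2) + γ - Complex.I * (Real.pi / 2)

lemma hankel1_eq_logF {lam : ℂ} (hl : lam ≠ 0) {r : ℝ} (hr : 0 < r) :
    hankel1 0 (lam * r) =
      (2 * Complex.I / Real.pi) * logF (lam ^ 2) (outgoingConst lam) (r ^ 2) := by
  have half_eq : lam * r / 2 = r * (lam / 2) := by ring
  rw [hankel1_zero, half_eq, cutLog_ofReal_mul hr (div_ne_zero hl two_ne_zero), logF,
    outgoingConst, Real.log_pow]
  push_cast
  ring_nf

lemma IsResonantState.regQ_eq_zero {ρ asq : ℝ} (hρ : 0 < ρ) {u : ℂ → ℂ} (hr : IsRadial u)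
    (h : IsResonantState (circularWell ρ asq) 0 u) : regQ asq (ρ ^ 2) = 0 := by
  obtain ⟨nontrivial, solution, outgoing⟩ := h
  obtain ⟨F, Q, profile, u_eq⟩ := solution.exists_isRadialProfile hρ.le hr
  obtain ⟨c, R, R_nonneg, hc⟩ := outgoing.exists_ae_eq_const_mul u_eq
  have σ_pos : 0 < ρ ^ 2 := pow_pos hρ 2
  have matching := profile.matching σ_pos u_eq nontrivial
    (profile.wronskian_eq_zero_of_ae σ_pos (fun s hs => isPairAt_reg _ hs.ne') R_nonneg (c := c) (by
      filter_upwards [hc] with r hr R_lt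
      simp [hr R_lt, regF, cliffordJ_zero]))
  simpa [regF, regQ, cliffordJ_zero] using matching

lemma IsResonantState.matching {ρ asq : ℝ} (hρ : 0 < ρ) {lam : ℂ} (hl : lam ≠ 0) {u : ℂ → ℂ}
    (hr : IsRadial u) (h : IsResonantState (circularWell ρ asq) lam u) :
    regQ (asq + lam ^ 2) (ρ ^ 2) * logF (lam ^ 2) (outgoingConst lam) (ρ ^ 2) =
      logQ (lam ^ 2) (outgoingConst lam) (ρ ^ 2) * regF (asq + lam ^ 2) (ρ ^ 2) := by
  obtain ⟨nontrivial, solution, outgoing⟩ := h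
  obtain ⟨F, Q, profile, u_eq⟩ := solution.exists_isRadialProfile hρ.le hr
  obtain ⟨c, R, R_nonneg, hc⟩ := outgoing.exists_ae_eq_const_mul u_eq
  refine profile.matching (pow_pos hρ 2) u_eq nontrivial (profile.wronskian_eq_zero_of_ae
    (pow_pos hρ 2) (fun s hs => isPairAt_log _ _ hs.ne') R_nonneg
    (c := c * (2 * Complex.I / Real.pi)) ?_)
  filter_upwards [hc] with r hr R_lt
  rw [hr R_lt, if_neg hl, hankel1_eq_logF hl (R_nonneg.trans_lt R_lt), mul_assoc]

/-! ### The logarithmic derivative of the regular solution -/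

/-- The logarithmic derivative `w J'(w) / J(w)` of the regular solution `J`, taken with respect to
`log w`; the radial Schrödinger equation turns into a Riccati equation for it. -/
def logDerivJ (w : ℂ) : ℂ :=
  w * deriv cliffordJ w / cliffordJ w

lemma regQ_eq_logDerivJ_mul {c : ℂ} {s : ℝ} (h : cliffordJ (c * s / 4) ≠ 0) :
    regQ c s = 4 * logDerivJ (c * s / 4) * regF c s := by
  rw [regQ, logDerivJ, regF]
  field_simp

lemma hasDerivAt_logDerivJ {w : ℂ} (hj : cliffordJ w ≠ 0) :
    HasDerivAt logDerivJ (-1 - logDerivJ w ^ 2 / w) w := by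
  refine (((hasDerivAt_id w).mul (hasDerivAt_deriv_cliffordJ w)).div (hasDerivAt_cliffordJ w)
    hj).congr_deriv ?_
  rw [logDerivJ]
  simp only [Pi.mul_apply, id_eq, one_mul]
  field_simp
  linear_combination cliffordJ w * cliffordJ_ode w

lemma isBigO_sub_of_isBigO_deriv {f f' : ℂ → ℂ} {w₀ : ℂ} {n : ℕ}
    (hf : ∀ᶠ w in 𝓝 w₀, HasDerivAt f (f' w) w) (hf' : f' =O[𝓝 w₀] fun w => (w - w₀) ^ n) :
    (fun w => f w - f w₀) =O[𝓝 w₀] fun w => (w - w₀) ^ (n + 1) := by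
  obtain ⟨C, C_pos, hC⟩ := hf'.exists_pos
  obtain ⟨r, r_pos, hr⟩ := Metric.eventually_nhds_iff_ball.1 (hf.and hC.bound)
  refine .of_bound C (Metric.eventually_nhds_iff_ball.2 ⟨r, r_pos, fun w hw => ?_⟩)
  rw [mem_ball_iff_norm] at hw
  have mem_ball {v : ℂ} (hv : v ∈ Metric.closedBall w₀ ‖w - w₀‖) : v ∈ Metric.ball w₀ r :=
    Metric.closedBall_subset_ball hw hv
  have norm_deriv_le (v : ℂ) (hv : v ∈ Metric.closedBall w₀ ‖w - w₀‖) :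
      ‖f' v‖ ≤ C * ‖w - w₀‖ ^ n := by
    refine (hr v (mem_ball hv)).2.trans ?_
    rw [norm_pow]
    gcongr
    exact mem_closedBall_iff_norm.1 hv
  have mean_value := Convex.norm_image_sub_le_of_norm_hasDerivWithin_le
    (fun v hv => (hr v (mem_ball hv)).1.hasDerivWithinAt) norm_deriv_le (convex_closedBall _ _)
    (Metric.mem_closedBall_self (norm_nonneg _)) (mem_closedBall_iff_norm.2 le_rfl)
  rwa [norm_pow, pow_succ, ← mul_assoc]

lemma isBigO_logDerivJ_add_sub {w₀ : ℂ} (hw : w₀ ≠ 0) (h : deriv cliffordJ w₀ = 0) :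
    (fun w => logDerivJ w + (w - w₀)) =O[𝓝 w₀] fun w => (w - w₀) ^ 3 := by
  have cliffordJ_ne := cliffordJ_ne_zero_of_deriv_eq_zero h
  have logDerivJ_eq_zero : logDerivJ w₀ = 0 := by simp [logDerivJ, h]
  have hasDerivAt_add : ∀ᶠ w in 𝓝 w₀,
      HasDerivAt (fun w => logDerivJ w + (w - w₀)) (-(logDerivJ w ^ 2 * w⁻¹)) w := by
    filter_upwards [continuous_cliffordJ.continuousAt.eventually_ne cliffordJ_ne] with w j_ne
    refine ((hasDerivAt_logDerivJ j_ne).add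
      ((hasDerivAt_id w).sub_const w₀)).congr_deriv ?_
    ring
  -- by the Riccati equation there is no quadratic term
  have isBigO_deriv : (fun w => -(logDerivJ w ^ 2 * w⁻¹)) =O[𝓝 w₀] fun w => (w - w₀) ^ 2 := by
    have isBigO_logDerivJ := (hasDerivAt_logDerivJ cliffordJ_ne).isBigO_sub
    simp only [logDerivJ_eq_zero, sub_zero] at isBigO_logDerivJ
    simpa using ((isBigO_logDerivJ.pow 2).mul
      ((continuousAt_inv₀ hw).isBigO_one ℂ)).neg_left
  simpa [logDerivJ_eq_zero] using isBigO_sub_of_isBigO_deriv hasDerivAt_add isBigO_deriv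

/-! ### The logarithmic derivative of the decaying solution -/

/-- The value `t` for which matching with the decaying solution reads `logDerivJ w = -t`. -/
def macdonaldRatio (y : ℝ) : ℝ :=
  macdonald 1 y / macdonald 0 y

lemma isLittleO_rpow_inv_log_pow {s : ℝ} (hs : 0 < s) (n : ℕ) :
    (fun y : ℝ => y ^ s) =o[𝓝[>] 0] fun y => (Real.log y)⁻¹ ^ n := by
  have isLittleO_log : (fun y => Real.log y ^ n) =o[𝓝[>] 0] fun y : ℝ => y ^ (-s) := by
    refine (isLittleO_norm_left.1 ?_)
    simpa using isLittleO_abs_log_rpow_rpow_nhdsGT_zero n (neg_lt_zero.2 hs)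
  have log_ne_zero : ∀ᶠ y in 𝓝[>] (0 : ℝ), Real.log y ≠ 0 :=
    Real.tendsto_log_nhdsGT_zero.eventually_ne_atBot 0
  refine (isLittleO_log.inv_rev ?_).congr' ?_ ?_
  · filter_upwards [log_ne_zero] with y log_ne h
    exact absurd h (pow_ne_zero n log_ne)
  · filter_upwards [self_mem_nhdsWithin] with y hy
    rw [Real.rpow_neg (le_of_lt hy), inv_inv]
  · exact .of_forall fun y => (inv_pow _ _).symm

lemma isLittleO_sqrt_mul_log :
    (fun y => √y * Real.log y) =o[𝓝[>] 0] fun y => (Real.log y)⁻¹ := by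
  refine ((isLittleO_rpow_inv_log_pow (s := 1 / 2) (by norm_num) 2).mul_isBigO
    (isBigO_refl Real.log _)).congr' ?_ ?_
  · exact .of_forall fun y => by simp only [Real.sqrt_eq_rpow]
  · filter_upwards [Real.tendsto_log_nhdsGT_zero.eventually_ne_atBot 0] with y log_ne
    field_simp

lemma isBigO_inv_macdonaldRatio_add_log_add :
    (fun y => (macdonaldRatio y)⁻¹ + Real.log y + 2 * γ) =O[𝓝[>] 0]
      fun y => √y * Real.log y := by
  have tendsto_sqrt : Tendsto (fun y => √y) (𝓝[>] 0) (𝓝 0) :=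
    (Real.continuous_sqrt.tendsto' 0 0 Real.sqrt_zero).mono_left nhdsWithin_le_nhds
  have tendsto_macdonald_one : Tendsto (macdonald 1) (𝓝[>] 0) (𝓝 1) := by
    simpa using (isBigO_macdonald_one_sub_one.trans_tendsto tendsto_sqrt).add_const 1
  have isBigO_log : (fun y => √y * Real.log y) =O[𝓝[>] 0] Real.log := by
    simpa using (tendsto_sqrt.isBigO_one ℝ).mul (isBigO_refl Real.log _)
  have isBigO_macdonald_zero : macdonald 0 =O[𝓝[>] 0] Real.log := by
    refine (((isBigO_macdonald_zero_add_log_add.trans isBigO_log).sub (isBigO_refl _ _)).sub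
      (isLittleO_const_log (2 * γ)).isBigO).congr_left fun y => ?_
    ring
  have isBigO_correction : (fun y => (macdonald 1 y - 1) * macdonald 0 y * (macdonald 1 y)⁻¹)
      =O[𝓝[>] 0] fun y => √y * Real.log y := by
    simpa using (isBigO_macdonald_one_sub_one.mul isBigO_macdonald_zero).mul
      ((tendsto_macdonald_one.inv₀ one_ne_zero).isBigO_one ℝ)
  refine (isBigO_macdonald_zero_add_log_add.sub isBigO_correction).congr' ?_ EventuallyEq.rfl
  filter_upwards [tendsto_macdonald_one.eventually_ne one_ne_zero] with y macdonald_one_ne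
  rw [macdonaldRatio, inv_div]
  field_simp
  ring

lemma isEquivalent_macdonaldRatio :
    macdonaldRatio ~[𝓝[>] 0] fun y => (-Real.log y)⁻¹ := by
  have isLittleO_log : (fun y => √y * Real.log y) =o[𝓝[>] 0] Real.log := by
    have tendsto_sqrt : Tendsto (fun y => √y) (𝓝[>] 0) (𝓝 0) :=
      (Real.continuous_sqrt.tendsto' 0 0 Real.sqrt_zero).mono_left nhdsWithin_le_nhds
    simpa using ((isLittleO_one_iff ℝ).2 tendsto_sqrt).mul_isBigO (isBigO_refl Real.log _)
  have isEquivalent_inv : (fun y => (macdonaldRatio y)⁻¹) ~[𝓝[>] 0] fun y => -Real.log y := by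
    refine (((isBigO_inv_macdonaldRatio_add_log_add.trans_isLittleO isLittleO_log).sub
      (isLittleO_const_log (2 * γ))).congr_left fun y => ?_).neg_right
    simp only [Pi.sub_apply]
    ring
  simpa only [Pi.inv_def, inv_inv] using isEquivalent_inv.inv

lemma isTheta_macdonaldRatio : macdonaldRatio =Θ[𝓝[>] 0] fun y => (Real.log y)⁻¹ := by
  have isEquivalent_neg : macdonaldRatio ~[𝓝[>] 0] fun y => -(Real.log y)⁻¹ := by
    simpa only [inv_neg] using isEquivalent_macdonaldRatio
  exact ⟨isEquivalent_neg.isBigO.of_neg_right, isEquivalent_neg.isBigO_symm.of_neg_left⟩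

lemma tendsto_macdonaldRatio : Tendsto macdonaldRatio (𝓝[>] 0) (𝓝 0) :=
  isTheta_macdonaldRatio.isBigO.trans_tendsto
    (tendsto_inv_atBot_zero.comp Real.tendsto_log_nhdsGT_zero)

lemma eventually_macdonald_zero_ne_zero : ∀ᶠ y in 𝓝[>] (0 : ℝ), macdonald 0 y ≠ 0 := by
  filter_upwards [isTheta_macdonaldRatio.eq_zero_iff,
    Real.tendsto_log_nhdsGT_zero.eventually_ne_atBot 0] with y ratio_eq_zero_iff log_ne h
  exact inv_ne_zero log_ne (ratio_eq_zero_iff.1 (by rw [macdonaldRatio, h, div_zero]))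

lemma isLittleO_id_macdonaldRatio_pow :
    (fun y => y) =o[𝓝[>] 0] fun y => macdonaldRatio y ^ 3 := by
  simpa using (isLittleO_rpow_inv_log_pow one_pos 3).trans_isBigO
    (isTheta_macdonaldRatio.isBigO_symm.pow 3)

/-! ### Eigenvalues near the threshold -/

lemma isEquivalent_of_isBigO_sub_pow {α : Type*} {l : Filter α} {t η : α → ℝ}
    (ht : Tendsto t l (𝓝 0)) (h : (fun a => η a - t a) =O[l] fun a => t a ^ 3) : η ~[l] t :=
  h.trans_isLittleO ((isLittleO_pow_id (by norm_num : 1 < 3)).comp_tendsto ht)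

lemma isBigO_inv_sub_inv {α : Type*} {l : Filter α} {t η : α → ℝ}
    (ht : Tendsto t l (𝓝 0)) (h : (fun a => η a - t a) =O[l] fun a => t a ^ 3) :
    (fun a => (t a)⁻¹ - (η a)⁻¹) =O[l] t := by
  have isTheta_η : η =Θ[l] t := (isEquivalent_of_isBigO_sub_pow ht h).isTheta
  refine ((h.mul (isBigO_refl (fun a => (t a)⁻¹) l)).mul isTheta_η.inv.isBigO).congr' ?_ ?_
  · filter_upwards [isTheta_η.eq_zero_iff] with a eq_zero_iff
    rcases eq_or_ne (t a) 0 with t_eq | t_ne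
    · simp [t_eq, eq_zero_iff.2 t_eq]
    · have η_ne : η a ≠ 0 := fun η_eq => t_ne (eq_zero_iff.1 η_eq)
      field_simp
  · refine .of_forall fun a => ?_
    rcases eq_or_ne (t a) 0 with t_eq | t_ne
    · simp [t_eq]
    · field_simp

section Threshold

variable {α : Type*} {l : Filter α} {W y : α → ℝ} {W₀ : ℝ}

lemma deriv_cliffordJ_eq_zero_of_matching [l.NeBot] (hW₀ : W₀ ≠ 0) (hW : Tendsto W l (𝓝 W₀))
    (hy : Tendsto y l (𝓝[>] 0))
    (matching : ∀ᶠ a in l, (W a : ℂ) * deriv cliffordJ (W a) =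
      -(macdonaldRatio (y a)) * cliffordJ (W a)) :
    deriv cliffordJ W₀ = 0 := by
  have tendsto_W : Tendsto (fun a => (W a : ℂ)) l (𝓝 (W₀ : ℂ)) :=
    (Complex.continuous_ofReal.tendsto W₀).comp hW
  have tendsto_ratio : Tendsto (fun a => (macdonaldRatio (y a) : ℂ)) l (𝓝 ((0 : ℝ) : ℂ)) :=
    (Complex.continuous_ofReal.tendsto 0).comp (tendsto_macdonaldRatio.comp hy)
  have tendsto_left := tendsto_W.mul ((continuous_deriv_cliffordJ.tendsto _).comp tendsto_W)
  have tendsto_right := tendsto_ratio.neg.mul ((continuous_cliffordJ.tendsto _).comp tendsto_W)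
  have limits_eq := tendsto_nhds_unique (tendsto_left.congr' matching) tendsto_right
  simpa [hW₀] using limits_eq

lemma isBigO_log_add_inv (hW₀ : W₀ ≠ 0) (hj : deriv cliffordJ W₀ = 0) (hW : Tendsto W l (𝓝 W₀))
    (hy : Tendsto y l (𝓝[>] 0))
    (matching : ∀ᶠ a in l, (W a : ℂ) * deriv cliffordJ (W a) =
      -(macdonaldRatio (y a)) * cliffordJ (W a)) :
    (fun a => Real.log (y a) + 2 * γ + (W a - W₀ + y a)⁻¹) =O[l] fun a => W a - W₀ + y a := by
  have tendsto_sub : Tendsto (fun a => W a - W₀) l (𝓝 0) := by simpa using hW.sub_const W₀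
  have tendsto_ratio : Tendsto (fun a => macdonaldRatio (y a)) l (𝓝 0) :=
    tendsto_macdonaldRatio.comp hy
  have isBigO_cube : (fun a => macdonaldRatio (y a) - (W a - W₀)) =O[l]
      fun a => (W a - W₀) ^ 3 := by
    have cliffordJ_ne : cliffordJ (W₀ : ℂ) ≠ 0 := cliffordJ_ne_zero_of_deriv_eq_zero hj
    have tendsto_W : Tendsto (fun a => (W a : ℂ)) l (𝓝 (W₀ : ℂ)) :=
      (Complex.continuous_ofReal.tendsto W₀).comp hW
    refine Complex.isBigO_ofReal_left.1 (Complex.isBigO_ofReal_right.1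
      (((isBigO_logDerivJ_add_sub (Complex.ofReal_ne_zero.2 hW₀) hj).comp_tendsto
        tendsto_W).neg_left.congr' ?_ (.of_forall fun a => by simp)))
    filter_upwards [matching, tendsto_W.eventually
      (continuous_cliffordJ.continuousAt.eventually_ne cliffordJ_ne)] with a matching_a j_ne
    simp only [Function.comp_apply, logDerivJ, matching_a, mul_div_cancel_right₀ _ j_ne]
    push_cast
    ring
  have isEquivalent_ratio : (fun a => macdonaldRatio (y a)) ~[l] fun a => W a - W₀ :=
    isEquivalent_of_isBigO_sub_pow tendsto_sub isBigO_cube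
  have isBigO_sub : (fun a => W a - W₀ + y a - macdonaldRatio (y a)) =O[l]
      fun a => macdonaldRatio (y a) ^ 3 := by
    refine ((isLittleO_id_macdonaldRatio_pow.comp_tendsto hy).isBigO.sub (isBigO_cube.trans
      (isEquivalent_ratio.isBigO_symm.pow 3))).congr_left fun a => ?_
    simp only [Function.comp_apply]
    ring
  have isBigO_inv_ratio : (fun a => (macdonaldRatio (y a))⁻¹ + Real.log (y a) + 2 * γ) =O[l]
      fun a => macdonaldRatio (y a) :=
    ((isBigO_inv_macdonaldRatio_add_log_add.trans_isLittleO isLittleO_sqrt_mul_log).isBigO.trans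
      isTheta_macdonaldRatio.isBigO_symm).comp_tendsto hy
  refine ((isBigO_inv_ratio.sub (isBigO_inv_sub_inv tendsto_ratio isBigO_sub)).trans
    (isEquivalent_of_isBigO_sub_pow tendsto_ratio isBigO_sub).isBigO_symm).congr_left fun a => ?_
  ring

end Threshold

lemma IsEigenfunction.mul_deriv_cliffordJ_eq {ρ asq E : ℝ} (hρ : 0 < ρ) (hE : E < 0) {ψ : ℂ → ℂ}
    (hr : IsRadial ψ) (h : IsEigenfunction (circularWell ρ asq) E ψ)
    (hm : macdonald 0 (-E * ρ ^ 2 / 4) ≠ 0) :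
    (((asq + E) * ρ ^ 2 / 4 : ℝ) : ℂ) * deriv cliffordJ ((asq + E) * ρ ^ 2 / 4 : ℝ) =
      -(macdonaldRatio (-E * ρ ^ 2 / 4)) * cliffordJ ((asq + E) * ρ ^ 2 / 4 : ℝ) := by
  have matching := h.matching hρ hE hr
  have arg_eq : ((asq : ℂ) + E) * (ρ ^ 2 : ℝ) / 4 = ((asq + E) * ρ ^ 2 / 4 : ℝ) := by
    push_cast
    ring
  have macdonald_ne : (macdonald 0 (-E * ρ ^ 2 / 4) : ℂ) ≠ 0 := Complex.ofReal_ne_zero.2 hm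
  rw [regQ, regF, arg_eq, (div_eq_iff (by norm_num)).1 arg_eq] at matching
  rw [macdonaldRatio, Complex.ofReal_div (macdonald 1 _), ← neg_div, div_mul_eq_mul_div,
    eq_div_iff macdonald_ne]
  linear_combination matching / 4

section Family

variable {ρ a₀ : ℝ} {E : ℝ → ℝ}

lemma tendsto_scaled_energy (hρ : 0 < ρ) (hE : Tendsto E (𝓝[<] 0) (𝓝[<] 0)) :
    Tendsto (fun ε => -E ε * ρ ^ 2 / 4) (𝓝[<] 0) (𝓝[>] 0) := by
  refine tendsto_nhdsWithin_iff.2 ⟨?_, ?_⟩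
  · simpa using ((tendsto_nhdsWithin_iff.1 hE).1.neg.mul_const (ρ ^ 2)).div_const 4
  · filter_upwards [hE.eventually self_mem_nhdsWithin] with ε E_neg
    exact div_pos (mul_pos (neg_pos.2 E_neg) (pow_pos hρ 2)) four_pos

lemma tendsto_scaled_depth (hE : Tendsto E (𝓝[<] 0) (𝓝[<] 0)) :
    Tendsto (fun ε => (a₀ ^ 2 - ε + E ε) * ρ ^ 2 / 4) (𝓝[<] 0) (𝓝 (a₀ ^ 2 * ρ ^ 2 / 4)) := by
  have tendsto_id : Tendsto (fun ε : ℝ => ε) (𝓝[<] 0) (𝓝 0) := nhdsWithin_le_nhds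
  simpa using (((tendsto_id.const_sub (a₀ ^ 2)).add
    (tendsto_nhdsWithin_iff.1 hE).1).mul_const (ρ ^ 2)).div_const 4

lemma eventually_mul_deriv_cliffordJ_eq (hρ : 0 < ρ)
    (hψ : ∀ᶠ ε in 𝓝[<] 0, ∃ ψ : ℂ → ℂ, IsRadial ψ ∧
      IsEigenfunction (circularWell ρ (a₀ ^ 2 - ε)) (E ε) ψ)
    (hE : Tendsto E (𝓝[<] 0) (𝓝[<] 0)) :
    ∀ᶠ ε in 𝓝[<] (0 : ℝ), (((a₀ ^ 2 - ε + E ε) * ρ ^ 2 / 4 : ℝ) : ℂ) *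
        deriv cliffordJ ((a₀ ^ 2 - ε + E ε) * ρ ^ 2 / 4 : ℝ) =
      -(macdonaldRatio (-E ε * ρ ^ 2 / 4)) *
        cliffordJ ((a₀ ^ 2 - ε + E ε) * ρ ^ 2 / 4 : ℝ) := by
  filter_upwards [hψ, hE.eventually self_mem_nhdsWithin,
    (tendsto_scaled_energy hρ hE).eventually eventually_macdonald_zero_ne_zero]
    with ε ⟨ψ, radial, eigenfunction⟩ E_neg macdonald_ne
  exact eigenfunction.mul_deriv_cliffordJ_eq hρ E_neg radial macdonald_ne

lemma deriv_cliffordJ_threshold (hρ : 0 < ρ) (ha₀ : a₀ ≠ 0)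
    (hψ : ∀ᶠ ε in 𝓝[<] 0, ∃ ψ : ℂ → ℂ, IsRadial ψ ∧
      IsEigenfunction (circularWell ρ (a₀ ^ 2 - ε)) (E ε) ψ)
    (hE : Tendsto E (𝓝[<] 0) (𝓝[<] 0)) :
    deriv cliffordJ (a₀ ^ 2 * ρ ^ 2 / 4 : ℝ) = 0 :=
  deriv_cliffordJ_eq_zero_of_matching (by positivity) (tendsto_scaled_depth hE)
    (tendsto_scaled_energy hρ hE) (eventually_mul_deriv_cliffordJ_eq hρ hψ hE)

lemma isBigO_log_scaled_energy (hρ : 0 < ρ) (ha₀ : a₀ ≠ 0)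
    (hψ : ∀ᶠ ε in 𝓝[<] 0, ∃ ψ : ℂ → ℂ, IsRadial ψ ∧
      IsEigenfunction (circularWell ρ (a₀ ^ 2 - ε)) (E ε) ψ)
    (hE : Tendsto E (𝓝[<] 0) (𝓝[<] 0)) :
    (fun ε => Real.log (-E ε * ρ ^ 2 / 4) + 2 * γ - 4 / (ρ ^ 2 * ε)) =O[𝓝[<] 0] fun ε => ε := by
  have sub_add_eq (ε : ℝ) : (a₀ ^ 2 - ε + E ε) * ρ ^ 2 / 4 - a₀ ^ 2 * ρ ^ 2 / 4 +
      -E ε * ρ ^ 2 / 4 = -(ρ ^ 2 / 4) * ε := by ring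
  have isBigO_log := isBigO_log_add_inv (by positivity) (deriv_cliffordJ_threshold hρ ha₀ hψ hE)
    (tendsto_scaled_depth hE) (tendsto_scaled_energy hρ hE)
    (eventually_mul_deriv_cliffordJ_eq hρ hψ hE)
  simp only [sub_add_eq] at isBigO_log
  refine (isBigO_log.trans (isBigO_const_mul_self _ _ _)).congr_left fun ε => ?_
  rw [mul_inv, inv_neg, inv_div, ← div_div]
  ring

lemma energy_asymptotics (hρ : 0 < ρ) (ha₀ : a₀ ≠ 0)
    (hψ : ∀ᶠ ε in 𝓝[<] 0, ∃ ψ : ℂ → ℂ, IsRadial ψ ∧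
      IsEigenfunction (circularWell ρ (a₀ ^ 2 - ε)) (E ε) ψ)
    (hE : Tendsto E (𝓝[<] 0) (𝓝[<] 0)) :
    ∃ f : ℝ → ℝ, f =O[𝓝[<] 0] (fun ε => ε) ∧ ∀ᶠ ε in 𝓝[<] 0,
      E ε = -(4 / ρ ^ 2) * Real.exp (4 / (ρ ^ 2 * ε) - 2 * γ) * (1 + f ε) := by
  set x := fun ε => Real.log (-E ε * ρ ^ 2 / 4) + 2 * γ - 4 / (ρ ^ 2 * ε) with x_def
  have isBigO_x : x =O[𝓝[<] 0] fun ε => ε := isBigO_log_scaled_energy hρ ha₀ hψ hE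
  have tendsto_x : Tendsto x (𝓝[<] 0) (𝓝 0) :=
    isBigO_x.trans_tendsto (tendsto_id.mono_left nhdsWithin_le_nhds)
  have isBigO_exp : (fun ε => Real.exp (x ε) - 1) =O[𝓝[<] 0] x := by
    simpa [Function.comp_def] using
      (Real.hasDerivAt_exp 0).isBigO_sub.comp_tendsto tendsto_x
  refine ⟨fun ε => Real.exp (x ε) - 1, isBigO_exp.trans isBigO_x, ?_⟩
  filter_upwards [(tendsto_scaled_energy hρ hE).eventually self_mem_nhdsWithin] with ε y_pos
  have exponent_eq : 4 / (ρ ^ 2 * ε) - 2 * γ + x ε = Real.log (-E ε * ρ ^ 2 / 4) := by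
    simp only [x_def]
    ring
  rw [add_sub_cancel, mul_assoc, ← Real.exp_add, exponent_eq, Real.exp_log y_pos]
  field_simp

end Family

/-! ### Absence of resonances -/

/-- The coefficient of `J(λ² s / 4)` at `s = ρ²` in the outgoing solution
`logF (λ ^ 2) (outgoingConst λ)`. -/
def outgoingLog (ρ : ℝ) (lam : ℂ) : ℂ :=
  Real.log ρ + outgoingConst lam

lemma outgoingLog_eq (ρ : ℝ) (lam : ℂ) :
    outgoingLog ρ lam = ((Real.log ρ + γ : ℝ) : ℂ) +
      starRingEnd ℂ (Complex.log (starRingEnd ℂ (-Complex.I * (lam / 2)))) := by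
  rw [outgoingLog, outgoingConst, cutLog]
  push_cast
  ring

lemma outgoingLog_re (ρ : ℝ) {lam : ℂ} (hl : lam ≠ 0) :
    (outgoingLog ρ lam).re = Real.log ‖lam‖ + (Real.log ρ + γ - Real.log 2) := by
  have norm_eq : ‖starRingEnd ℂ (-Complex.I * (lam / 2))‖ = ‖lam‖ / 2 := by simp
  rw [outgoingLog_eq, Complex.add_re, Complex.ofReal_re, Complex.conj_re, Complex.log_re, norm_eq,
    Real.log_div (norm_ne_zero_iff.2 hl) two_ne_zero]
  ring

lemma abs_outgoingLog_im_le (ρ : ℝ) (lam : ℂ) : |(outgoingLog ρ lam).im| ≤ Real.pi := by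
  rw [outgoingLog_eq, Complex.add_im, Complex.ofReal_im, zero_add, Complex.conj_im, abs_neg,
    Complex.log_im]
  exact Complex.abs_arg_le_pi _

lemma tendsto_outgoingLog_re (ρ : ℝ) :
    Tendsto (fun lam => (outgoingLog ρ lam).re) (𝓝[≠] 0) atBot := by
  refine (tendsto_atBot_add_const_right (𝓝[≠] 0) (Real.log ρ + γ - Real.log 2)
    (Real.tendsto_log_nhdsGT_zero.comp (tendsto_norm_nhdsNE_zero (E := ℂ)))).congr' ?_
  filter_upwards [self_mem_nhdsWithin] with lam lam_ne
  exact (outgoingLog_re ρ lam_ne).symm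

lemma tendsto_sq_mul_outgoingLog (ρ : ℝ) :
    Tendsto (fun lam => lam ^ 2 * outgoingLog ρ lam) (𝓝[≠] 0) (𝓝 0) := by
  set c := Real.log ρ + γ - Real.log 2
  have tendsto_majorant :
      Tendsto (fun r => |r * (r * Real.log r) + r ^ 2 * c| + r ^ 2 * Real.pi) (𝓝 0) (𝓝 0) := by
    have continuous_majorant :
        Continuous fun r => |r * (r * Real.log r) + r ^ 2 * c| + r ^ 2 * Real.pi := by
      have := Real.continuous_mul_log
      fun_prop
    exact continuous_majorant.tendsto' 0 0 (by simp)
  refine squeeze_zero_norm' ?_ ((tendsto_majorant.comp (continuous_norm.tendsto' 0 0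
    norm_zero)).mono_left nhdsWithin_le_nhds)
  filter_upwards [self_mem_nhdsWithin] with lam lam_ne
  calc ‖lam ^ 2 * outgoingLog ρ lam‖
      ≤ ‖lam‖ ^ 2 * (|(outgoingLog ρ lam).re| + |(outgoingLog ρ lam).im|) := by
        rw [norm_mul, norm_pow]
        gcongr
        exact Complex.norm_le_abs_re_add_abs_im _
    _ ≤ ‖lam‖ ^ 2 * (|Real.log ‖lam‖ + c| + Real.pi) := by
        rw [outgoingLog_re ρ lam_ne]
        gcongr
        exact abs_outgoingLog_im_le ρ lam
    _ = |‖lam‖ * (‖lam‖ * Real.log ‖lam‖) + ‖lam‖ ^ 2 * c| + ‖lam‖ ^ 2 * Real.pi := by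
        rw [mul_add, ← abs_sq ‖lam‖, ← abs_mul, abs_sq]
        ring_nf

lemma tendsto_mul_of_matching {α : Type*} {l : Filter α} {g w v L : α → ℂ}
    (hg : g ~[l] fun a => v a - w a) (hw : Tendsto w l (𝓝 0))
    (hL : Tendsto (fun a => (L a).re) l atBot) (hwL : Tendsto (fun a => w a * L a) l (𝓝 0))
    (matching : ∀ᶠ a in l, 2 * g a * (L a * cliffordJ (w a) - cliffordN (w a)) =
      cliffordJ (w a) + 2 * w a * (L a * deriv cliffordJ (w a) - deriv cliffordN (w a))) :
    Tendsto (fun a => v a * L a) l (𝓝 (1 / 2)) := by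
  have tendsto_norm_L : Tendsto (fun a => ‖L a‖) l atTop :=
    tendsto_atTop_mono (fun a => Complex.abs_re_le_norm (L a)) (tendsto_abs_atBot_atTop.comp hL)
  have tendsto_inv_L : Tendsto (fun a => (L a)⁻¹) l (𝓝 0) :=
    tendsto_inv₀_cobounded.comp (tendsto_norm_atTop_iff_cobounded.1 tendsto_norm_L)
  have tendsto_J := (continuous_cliffordJ.tendsto' 0 1 cliffordJ_zero).comp hw
  have tendsto_N := (continuous_cliffordN.tendsto' 0 0 cliffordN_zero).comp hw
  have tendsto_left : Tendsto (fun a => cliffordJ (w a) - (L a)⁻¹ * cliffordN (w a)) l (𝓝 1) := by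
    simpa using tendsto_J.sub (tendsto_inv_L.mul tendsto_N)
  have tendsto_right : Tendsto (fun a => cliffordJ (w a) + 2 * (w a * L a *
      deriv cliffordJ (w a) - w a * deriv cliffordN (w a))) l (𝓝 1) := by
    simpa using tendsto_J.add (((hwL.mul ((continuous_deriv_cliffordJ.tendsto 0).comp hw)).sub
      (hw.mul ((continuous_deriv_cliffordN.tendsto 0).comp hw))).const_mul 2)
  have tendsto_gL : Tendsto (fun a => g a * L a) l (𝓝 (1 / 2)) := by
    have tendsto_half := (tendsto_right.div tendsto_left one_ne_zero).div_const 2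
    rw [div_one] at tendsto_half
    refine tendsto_half.congr' ?_
    filter_upwards [matching, tendsto_left.eventually_ne one_ne_zero,
      tendsto_norm_L.eventually_ne_atTop 0] with a matching_a left_ne norm_L_ne
    have L_ne : L a ≠ 0 := norm_ne_zero_iff.1 norm_L_ne
    rw [Pi.div_apply, div_div, div_eq_iff (mul_ne_zero left_ne two_ne_zero)]
    field_simp
    linear_combination -matching_a
  have tendsto_diff : Tendsto (fun a => (v a - w a) * L a) l (𝓝 (1 / 2)) :=
    (hg.mul IsEquivalent.refl).tendsto_nhds tendsto_gL
  simpa using (tendsto_diff.add hwL).congr fun a => by ring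

lemma IsResonantState.logDerivJ_matching {ρ asq : ℝ} (hρ : 0 < ρ) {lam w : ℂ} (hl : lam ≠ 0)
    (w_eq : w = lam ^ 2 * ρ ^ 2 / 4) (hj : cliffordJ (asq * ρ ^ 2 / 4 + w) ≠ 0) {u : ℂ → ℂ}
    (hr : IsRadial u) (h : IsResonantState (circularWell ρ asq) lam u) :
    2 * logDerivJ (asq * ρ ^ 2 / 4 + w) *
        (outgoingLog ρ lam * cliffordJ w - cliffordN w) =
      cliffordJ w + 2 * w * (outgoingLog ρ lam * deriv cliffordJ w - deriv cliffordN w) := by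
  have matching := h.matching hρ hl hr
  have arg_eq : (asq + lam ^ 2) * (ρ ^ 2 : ℝ) / 4 = asq * ρ ^ 2 / 4 + w := by
    rw [w_eq]
    push_cast
    ring
  have four_mul_eq : lam ^ 2 * (ρ ^ 2 : ℝ) = 4 * w := by
    rw [w_eq]
    push_cast
    ring
  have regF_ne : regF (asq + lam ^ 2) (ρ ^ 2) ≠ 0 := by rwa [regF, arg_eq]
  rw [regQ_eq_logDerivJ_mul (by rwa [arg_eq]), arg_eq, mul_right_comm] at matching
  have matching_div := mul_right_cancel₀ regF_ne matching
  have log_eq : (Real.log (ρ ^ 2) : ℂ) / 2 = Real.log ρ := by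
    rw [Real.log_pow]
    push_cast
    ring
  rw [logF, logQ, log_eq, four_mul_eq, mul_div_cancel_left₀ w (by norm_num : (4 : ℂ) ≠ 0),
    ← outgoingLog] at matching_div
  linear_combination matching_div / 2

lemma hasDerivAt_logDerivJ_of_deriv_eq_zero {w₀ : ℂ} (h : deriv cliffordJ w₀ = 0) :
    HasDerivAt logDerivJ (-1) w₀ := by
  simpa [logDerivJ, h] using hasDerivAt_logDerivJ (cliffordJ_ne_zero_of_deriv_eq_zero h)

lemma isEquivalent_logDerivJ {w₀ : ℂ} (h : deriv cliffordJ w₀ = 0) :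
    logDerivJ ~[𝓝 w₀] fun w => w₀ - w := by
  have logDerivJ_eq_zero : logDerivJ w₀ = 0 := by simp [logDerivJ, h]
  have isLittleO_logDerivJ := (hasDerivAt_logDerivJ_of_deriv_eq_zero h).isLittleO
  simp only [logDerivJ_eq_zero, sub_zero, smul_eq_mul, mul_neg, mul_one,
    neg_sub] at isLittleO_logDerivJ
  exact isLittleO_logDerivJ.trans_isBigO (isBigO_of_le _ fun w => (norm_sub_rev w w₀).le)

section Resonances

variable {ρ a₀ : ℝ}

lemma eventually_not_isResonantState_zero (hρ : 0 < ρ)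
    (hj : deriv cliffordJ (a₀ ^ 2 * ρ ^ 2 / 4 : ℝ) = 0) :
    ∀ᶠ ε in 𝓝[>] (0 : ℝ),
      ¬ ∃ u, IsRadial u ∧ IsResonantState (circularWell ρ (a₀ ^ 2 - ε)) 0 u := by
  have cliffordJ_ne := cliffordJ_ne_zero_of_deriv_eq_zero hj
  have logDerivJ_ne : ∀ᶠ w in 𝓝[≠] ((a₀ ^ 2 * ρ ^ 2 / 4 : ℝ) : ℂ), logDerivJ w ≠ 0 :=
    (hasDerivAt_logDerivJ_of_deriv_eq_zero hj).eventually_ne (by norm_num)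
  have tendsto_w : Tendsto (fun ε : ℝ => (((a₀ ^ 2 - ε) * ρ ^ 2 / 4 : ℝ) : ℂ)) (𝓝[>] 0)
      (𝓝[≠] ((a₀ ^ 2 * ρ ^ 2 / 4 : ℝ) : ℂ)) := by
    refine tendsto_nhdsWithin_iff.2 ⟨?_, ?_⟩
    · exact (Continuous.tendsto' (by fun_prop) 0 _ (by simp)).mono_left nhdsWithin_le_nhds
    · filter_upwards [self_mem_nhdsWithin] with ε ε_pos
      rw [mem_compl_iff, mem_singleton_iff, Complex.ofReal_inj]
      have shift_pos : 0 < ε * ρ ^ 2 / 4 := div_pos (mul_pos ε_pos (pow_pos hρ 2)) four_pos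
      linarith
  filter_upwards [tendsto_w.eventually logDerivJ_ne,
    tendsto_w.eventually (nhdsWithin_le_nhds
      (continuous_cliffordJ.continuousAt.eventually_ne cliffordJ_ne))]
    with ε g_ne j_ne ⟨u, radial, resonant⟩
  have regQ_eq := resonant.regQ_eq_zero hρ radial
  have arg_eq : ((a₀ ^ 2 - ε : ℝ) : ℂ) * (ρ ^ 2 : ℝ) / 4 =
      ((a₀ ^ 2 - ε) * ρ ^ 2 / 4 : ℝ) := by
    push_cast
    ring
  rw [regQ_eq_logDerivJ_mul (by rwa [arg_eq]), regF, arg_eq] at regQ_eq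
  exact mul_ne_zero (mul_ne_zero (by norm_num) g_ne) j_ne regQ_eq

lemma tendsto_mul_outgoingLog_of_isResonantState {α : Type*} {l : Filter α} {ε : α → ℝ}
    {lam : α → ℂ} (hρ : 0 < ρ) (hj : deriv cliffordJ (a₀ ^ 2 * ρ ^ 2 / 4 : ℝ) = 0)
    (hε : Tendsto ε l (𝓝 0)) (hlam : Tendsto lam l (𝓝[≠] 0))
    (h : ∀ᶠ a in l, ∃ u, IsRadial u ∧
      IsResonantState (circularWell ρ (a₀ ^ 2 - ε a)) (lam a) u) :
    Tendsto (fun a => ((ε a * ρ ^ 2 / 4 : ℝ) : ℂ) * outgoingLog ρ (lam a)) l (𝓝 (1 / 2)) := by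
  set w₀ : ℂ := ((a₀ ^ 2 * ρ ^ 2 / 4 : ℝ) : ℂ) with w₀_def
  have tendsto_w : Tendsto (fun a => lam a ^ 2 * ρ ^ 2 / 4) l (𝓝 0) := by
    simpa using (((tendsto_nhdsWithin_iff.1 hlam).1.pow 2).mul_const ((ρ : ℂ) ^ 2)).div_const 4
  have tendsto_η : Tendsto (fun a => ((ε a * ρ ^ 2 / 4 : ℝ) : ℂ)) l (𝓝 0) :=
    (Continuous.tendsto' (f := fun x : ℝ => ((x * ρ ^ 2 / 4 : ℝ) : ℂ)) (by fun_prop) 0 0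
      (by simp)).comp hε
  have sub_arg_eq (a : α) : w₀ - (((a₀ ^ 2 - ε a : ℝ) : ℂ) * ρ ^ 2 / 4 +
      lam a ^ 2 * ρ ^ 2 / 4) = ((ε a * ρ ^ 2 / 4 : ℝ) : ℂ) - lam a ^ 2 * ρ ^ 2 / 4 := by
    rw [w₀_def]
    push_cast
    ring
  have tendsto_arg : Tendsto (fun a => ((a₀ ^ 2 - ε a : ℝ) : ℂ) * ρ ^ 2 / 4 +
      lam a ^ 2 * ρ ^ 2 / 4) l (𝓝 w₀) := by
    simpa only [← sub_arg_eq, sub_sub_cancel, sub_zero] using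
      (tendsto_η.sub tendsto_w).const_sub w₀
  have isEquivalent_g := (isEquivalent_logDerivJ hj).comp_tendsto tendsto_arg
  simp only [Function.comp_def, sub_arg_eq] at isEquivalent_g
  refine tendsto_mul_of_matching isEquivalent_g tendsto_w
    ((tendsto_outgoingLog_re ρ).comp hlam) ?_ ?_
  · have tendsto_prod := ((tendsto_sq_mul_outgoingLog ρ).comp hlam).mul_const ((ρ : ℂ) ^ 2 / 4)
    rw [zero_mul] at tendsto_prod
    refine tendsto_prod.congr fun a => ?_
    simp only [Function.comp_apply]
    ring
  · filter_upwards [h, hlam.eventually self_mem_nhdsWithin, tendsto_arg.eventually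
      (continuous_cliffordJ.continuousAt.eventually_ne (cliffordJ_ne_zero_of_deriv_eq_zero hj))]
      with a ⟨u, radial, resonant⟩ lam_ne j_ne
    exact resonant.logDerivJ_matching hρ lam_ne rfl j_ne radial

lemma eventually_not_isResonantState_ne_zero (hρ : 0 < ρ)
    (hj : deriv cliffordJ (a₀ ^ 2 * ρ ^ 2 / 4 : ℝ) = 0) :
    ∀ᶠ p : ℝ × ℂ in 𝓝[>] 0 ×ˢ 𝓝[≠] 0,
      ¬ ∃ u, IsRadial u ∧ IsResonantState (circularWell ρ (a₀ ^ 2 - p.1)) p.2 u := by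
  by_contra frequently_resonant
  set S := {p : ℝ × ℂ | ∃ u, IsRadial u ∧ IsResonantState (circularWell ρ (a₀ ^ 2 - p.1)) p.2 u}
  set l := (𝓝[>] (0 : ℝ) ×ˢ 𝓝[≠] (0 : ℂ)) ⊓ 𝓟 S
  have neBot : l.NeBot := frequently_mem_iff_neBot.1 frequently_resonant
  have tendsto_fst : Tendsto Prod.fst l (𝓝[>] 0) := tendsto_fst.mono_left inf_le_left
  have tendsto_snd : Tendsto Prod.snd l (𝓝[≠] 0) := tendsto_snd.mono_left inf_le_left
  have tendsto_half := (Complex.continuous_re.tendsto _).comp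
    (tendsto_mul_outgoingLog_of_isResonantState hρ hj
      (tendsto_fst.mono_right nhdsWithin_le_nhds) tendsto_snd
      (mem_inf_of_right (mem_principal_self S)))
  have re_le_zero : ((1 / 2 : ℂ)).re ≤ 0 := by
    refine le_of_tendsto tendsto_half ?_
    filter_upwards [tendsto_fst.eventually self_mem_nhdsWithin,
      ((tendsto_outgoingLog_re ρ).comp tendsto_snd).eventually_le_atBot 0] with p p_pos re_le
    rw [Function.comp_apply, Complex.re_ofReal_mul]
    exact mul_nonpos_of_nonneg_of_nonpos
      (div_pos (mul_pos p_pos (pow_pos hρ 2)) four_pos).le re_le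
  norm_num at re_le_zero

lemma exists_forall_not_isResonantState (hρ : 0 < ρ)
    (hj : deriv cliffordJ (a₀ ^ 2 * ρ ^ 2 / 4 : ℝ) = 0) :
    ∃ δ₀ > (0 : ℝ), ∃ ε₀ > (0 : ℝ), ∀ ε : ℝ, 0 < ε → ε < ε₀ → ∀ lam : ℂ, ‖lam‖ < δ₀ →
      ¬ ∃ u, IsRadial u ∧ IsResonantState (circularWell ρ (a₀ ^ 2 - ε)) lam u := by
  have eventually_not : ∀ᶠ p : ℝ × ℂ in 𝓝[>] 0 ×ˢ 𝓝 0,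
      ¬ ∃ u, IsRadial u ∧ IsResonantState (circularWell ρ (a₀ ^ 2 - p.1)) p.2 u := by
    rw [← pure_sup_nhdsNE, prod_sup, prod_pure]
    exact eventually_sup.2 ⟨eventually_map.2 (eventually_not_isResonantState_zero hρ hj),
      eventually_not_isResonantState_ne_zero hρ hj⟩
  obtain ⟨⟨ε₀, δ₀⟩, ⟨ε₀_pos, δ₀_pos⟩, h⟩ :=
    ((nhdsGT_basis 0).prod Metric.nhds_basis_ball).eventually_iff.1 eventually_not
  exact ⟨δ₀, δ₀_pos, ε₀, ε₀_pos, fun ε ε_pos ε_lt lam lam_lt =>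
    h (x := (ε, lam)) ⟨⟨ε_pos, ε_lt⟩, mem_ball_zero_iff.2 lam_lt⟩⟩

end Resonances

end CircularWell

end

theorem lemmal_general {ρ a₀ : ℝ} (hρ : 0 < ρ) (ha₀ : a₀ ≠ 0) {E : ℝ → ℝ}
    (hψ : ∀ᶠ ε in nhdsWithin (0 : ℝ) (Set.Iio 0), ∃ ψ : ℂ → ℂ, CircularWell.IsRadial ψ ∧
      CircularWell.IsEigenfunction (CircularWell.circularWell ρ (a₀ ^ 2 - ε)) (E ε) ψ)
    (hE : Filter.Tendsto E (nhdsWithin 0 (Set.Iio 0)) (nhdsWithin 0 (Set.Iio 0))) :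
    CircularWell.besselJ 1 ((ρ * a₀ : ℝ) : ℂ) = 0 ∧
    (∃ δ₀ > (0 : ℝ), ∃ ε₀ > (0 : ℝ), ∀ ε : ℝ, 0 < ε → ε < ε₀ → ∀ lam : ℂ, ‖lam‖ < δ₀ →
      ¬ ∃ u : ℂ → ℂ, CircularWell.IsRadial u ∧
        CircularWell.IsResonantState (CircularWell.circularWell ρ (a₀ ^ 2 - ε)) lam u) ∧
    (∃ f : ℝ → ℝ, f =O[nhdsWithin 0 (Set.Iio 0)] (fun ε : ℝ => ε) ∧
      ∀ᶠ ε in nhdsWithin (0 : ℝ) (Set.Iio 0),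
        E ε = -(4 / ρ ^ 2) *
          Real.exp (4 / (ρ ^ 2 * ε) - 2 * Real.eulerMascheroniConstant) * (1 + f ε)) := by
  have threshold := CircularWell.deriv_cliffordJ_threshold hρ ha₀ hψ hE
  have argument_ne_zero : ((ρ * a₀ : ℝ) : ℂ) ≠ 0 :=
    Complex.ofReal_ne_zero.2 (mul_ne_zero hρ.ne' ha₀)
  have argument_sq : ((ρ * a₀ : ℝ) : ℂ) ^ 2 / 4 = (a₀ ^ 2 * ρ ^ 2 / 4 : ℝ) := by
    push_cast
    ring
  refine ⟨?_, CircularWell.exists_forall_not_isResonantState hρ threshold,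
    CircularWell.energy_asymptotics hρ ha₀ hψ hE⟩
  rw [CircularWell.besselJ_one argument_ne_zero, argument_sq, threshold, mul_zero]

theorem lemmal (ρ a₀ ε₁ : ℝ) (hρ : 0 < ρ) (ha₀ : 0 < a₀) (hε₁ : 0 < ε₁)
    (E : ℝ → ℝ)
    (hψ : ∀ ε ∈ Set.Ioo (-ε₁) 0, ∃ ψ : ℂ → ℂ, CircularWell.IsRadial ψ ∧
      CircularWell.IsEigenfunction (CircularWell.circularWell ρ (a₀ ^ 2 - ε)) (E ε) ψ)
    -- `E_ε ↑ 0` as `ε ↑ 0`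
    (hE : Filter.Tendsto E (nhdsWithin 0 (Set.Iio 0)) (nhdsWithin 0 (Set.Iio 0))) :
    CircularWell.besselJ 1 ((ρ * a₀ : ℝ) : ℂ) = 0 ∧
    (∃ δ₀ > (0 : ℝ), ∃ ε₀ > (0 : ℝ), ∀ ε : ℝ, 0 < ε → ε < ε₀ →
      ∀ lam : ℂ, ‖lam‖ < δ₀ → |Complex.arg lam| ≤ Real.pi / 2 →
        ¬ ∃ u : ℂ → ℂ, CircularWell.IsRadial u ∧
          CircularWell.IsResonantState (CircularWell.circularWell ρ (a₀ ^ 2 - ε)) lam u) ∧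
    (∃ f : ℝ → ℝ, f =O[nhdsWithin 0 (Set.Iio 0)] (fun ε : ℝ => ε) ∧
      ∀ᶠ ε in nhdsWithin (0 : ℝ) (Set.Iio 0),
        E ε = -(4 / ρ ^ 2) *
          Real.exp (4 / (ρ ^ 2 * ε) - 2 * Real.eulerMascheroniConstant) * (1 + f ε)) := by
  obtain ⟨bessel_zero, ⟨δ₀, δ₀_pos, ε₀, ε₀_pos, no_resonance⟩, asymptotics⟩ := lemmal_general hρ
    ha₀.ne' (Filter.eventually_of_mem (Ioo_mem_nhdsLT (neg_lt_zero.2 hε₁)) hψ) hE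
  exact ⟨bessel_zero, ⟨δ₀, δ₀_pos, ε₀, ε₀_pos, fun ε ε_pos ε_lt lam lam_lt _ =>
    no_resonance ε ε_pos ε_lt lam lam_lt⟩, asymptotics⟩
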